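/- **Theorem (fully smooth bipartite economical convex split).** All Hilbert spaces are finite dimensional and all logarithms are to base $2$. A *subnormalised density matrix* is a positive semidefinite matrix with trace at most one. Write $\|T\|_1:=\mathrm{Tr}\,(T^\dagger T)^{1/2}$, $\|T\|_2:=(\mathrm{Tr}\,T^\dagger T)^{1/2}$. For a subnormalised density matrix $\alpha$ and a positive semidefinite matrix $\beta$ on the same space let $$D_2(\alpha\|\beta):=2\log\|\beta^{-1/4}\alpha\beta^{-1/4}\|_2\ \text{ if } \mathrm{supp}(\alpha)\subseteq\mathrm{supp}(\beta),\qquad D_2(\alpha\|\beta):=+\infty\ \text{ otherwise},$$ with negative powers taken on the support of $\beta$, and let $D_2^\epsilon(\alpha\|\beta):=\min_{\alpha'}D_2(\alpha'\|\beta)$, the minimum being over all subnormalised density matrices $\alpha'$ with $\|\alpha'-\alpha\|_1\le\epsilon\,\mathrm{Tr}\,\alpha$. Let $\mu$ denote the completely mixed state. *Unitary families.* Let $X'$ be a Hilbert space of the same dimension as $X$, and let $\{|s\rangle\}_{s\in S}$ be the product basis of $X'^4:=(X')^{\otimes 4}$, so $|S|=|X|^4$. A family $\{V_a^{XX'^4}\}_{a\in[A]}$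 is called *admissible* if there are $N\in\mathbb N$, unitaries $U_1,\dots,U_N$ on $X$ forming a 1-design, i.e. $\frac1N\sum_{d=1}^N U_d\,\omega\,U_d^\dagger=(\mathrm{Tr}\,\omega)\,\mu^X$ for every matrix $\omega$ on $X$, and functions $h_a:S\to[N]$, $a\in[A]$, that are pairwise independent hash functions (for uniformly random $s\in S$ each $h_a(s)$ is uniform on $[N]$, and $h_a(s),h_{a'}(s)$ are independent whenever $a\ne a'$), such that $$V_a=\sum_{s\in S}U_{h_a(s)}^{X}\otimes|s\rangle\langle s|^{X'^4}\qquad(a\in[A]).$$ Admissible families $\{W_b^{YY'^4}\}_{b\in[B]}$ are defined in the same way. *Statement.* Let $\rho^{XYM}\neq0$ be a subnormalised density matrix, $0<\epsilon<1$, $A,B$ positive integers, and let $\{V_a^{XX'^4}\}_{a\in[A]}$, $\{W_b^{YY'^4}\}_{b\in[B]}$ be admissible families. Define the convex split state $$\sigma:=\frac1{AB}\sum_{a=1}^A\sum_{b=1}^B(V_a\otimes W_b\otimes 1^M)\,(\rho^{XYM}\otimes\mu^{X'^4Y'^4})\,(V_a\otimes W_b\otimes 1^M)^\dagger$$ and the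 fully decoupled state $\tau:=\mu^X\otimes\mu^Y\otimes\rho^M\otimes\mu^{X'^4Y'^4}$. Suppose $$\log A> D_2^\epsilon(\rho^{XM}\|\mu^X\otimes\rho^M)+\log\epsilon^{-2},\qquad \log B> D_2^\epsilon(\rho^{YM}\|\mu^Y\otimes\rho^M)+\log\epsilon^{-2},$$ $$\log A+\log B> D_2^\epsilon(\rho^{XYM}\|\mu^X\otimes\mu^Y\otimes\rho^M)+\log\epsilon^{-2}.$$ Then $$\|\sigma-\tau\|_1<8\epsilon\left(\mathrm{Tr}\,\rho+\sqrt{\mathrm{Tr}\,\rho}\right),$$ which is $16\epsilon\,(\mathrm{Tr}\,\rho)=16\epsilon$ if $\rho$ is normalised. If moreover the three inequalities remain true with $\log(\mathrm{Tr}\,\rho)^{-1}$ added to each right hand side (no further condition if $\mathrm{Tr}\,\rho=1$), then $$\|\sigma-\tau\|_1<16\epsilon\,(\mathrm{Tr}\,\rho).$$ -/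

import Mathlib

open scoped Kronecker

noncomputable section

namespace ConvexSplit

open scoped ComplexOrder

/-! Operators on the finite dimensional Hilbert space with orthonormal basis indexed by a finite
type `n` are matrices `Matrix n n ℂ`; a tensor product of Hilbert spaces has the product type as
its index type.  All logarithms are to base two. -/

variable {n x y m S K : Type*} [Fintype n] [DecidableEq n] [Fintype x] [DecidableEq x]
  [Fintype y] [DecidableEq y] [Fintype m] [DecidableEq m] [Fintype S] [DecidableEq S]

/-- Trace norm (Schatten 1-norm) `Tr ((M† M)^{1/2})`. -/
def traceNorm (M : Matrix n n ℂ) : ℝ :=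
  (cfc Real.sqrt (M.conjTranspose * M)).trace.re

/-- Schatten 2-norm `(Tr (M† M))^{1/2}`. -/
def schattenTwoNorm (M : Matrix n n ℂ) : ℝ :=
  Real.sqrt (M.conjTranspose * M).trace.re

/-- Real power `β ^ s` of a positive semidefinite matrix, through its eigendecomposition.  For
`s ≠ 0` Mathlib's `0 ^ s = 0`, so a negative power is the power of the Moore-Penrose
pseudoinverse. -/
def psdPow (β : Matrix n n ℂ) (s : ℝ) : Matrix n n ℂ :=
  cfc (fun t : ℝ => t ^ s) β

/-- Support of a Hermitian matrix: the span of its eigenvectors with nonzero eigenvalue, which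
is its range. -/
def support (M : Matrix n n ℂ) : Submodule ℂ (n → ℂ) :=
  LinearMap.range M.mulVecLin

/-- Subnormalised density matrix. -/
def IsSubnormalized (α : Matrix n n ℂ) : Prop :=
  α.PosSemidef ∧ α.trace.re ≤ 1

/-- Base two logarithm of a nonnegative real, with `log 0 = -∞`. -/
def log2 (r : ℝ) : EReal :=
  if r ≤ 0 then ⊥ else ((Real.logb 2 r : ℝ) : EReal)

open Classical in
/-- Rényi-2 divergence `D₂(α ‖ β) = 2 log ‖β^{-1/4} α β^{-1/4}‖₂` if `supp α ≤ supp β`, and `+∞`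
otherwise. -/
def renyiTwo (α β : Matrix n n ℂ) : EReal :=
  if support α ≤ support β then
    2 * log2 (schattenTwoNorm (psdPow β (-(1 / 4)) * α * psdPow β (-(1 / 4))))
  else ⊤

/-- Smooth Rényi-2 divergence `D₂^ε(α ‖ β)`: the minimum of `D₂(α' ‖ β)` over the subnormalised
density matrices `α'` with `‖α' - α‖₁ ≤ ε Tr α`. -/
def smoothRenyiTwo (ε : ℝ) (α β : Matrix n n ℂ) : EReal :=
  ⨅ α' ∈ {α' : Matrix n n ℂ | IsSubnormalized α' ∧ traceNorm (α' - α) ≤ ε * α.trace.re},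
    renyiTwo α' β

variable (n) in
/-- Completely mixed state. -/
def mixed : Matrix n n ℂ :=
  (Fintype.card n : ℂ)⁻¹ • (1 : Matrix n n ℂ)

/-- The marginal `ρ^{XM}` of `ρ^{XYM}`. -/
def marginalXM (ρ : Matrix (x × y × m) (x × y × m) ℂ) : Matrix (x × m) (x × m) ℂ :=
  Matrix.of fun i j => ∑ b : y, ρ (i.1, b, i.2) (j.1, b, j.2)

/-- The marginal `ρ^{YM}` of `ρ^{XYM}`. -/
def marginalYM (ρ : Matrix (x × y × m) (x × y × m) ℂ) : Matrix (y × m) (y × m) ℂ :=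
  Matrix.of fun i j => ∑ a : x, ρ (a, i) (a, j)

/-- The marginal `ρ^M` of `ρ^{XYM}`. -/
def marginalM (ρ : Matrix (x × y × m) (x × y × m) ℂ) : Matrix m m ℂ :=
  Matrix.of fun i j => ∑ a : x, ∑ b : y, ρ (a, b, i) (a, b, j)

/-- A 1-design of unitaries, indexed by `Fin N`: averaging the conjugations by its members is
the completely depolarising map. -/
def IsOneDesign {N : ℕ} (U : Fin N → Matrix x x ℂ) : Prop :=
  (∀ d, U d ∈ Matrix.unitaryGroup x ℂ) ∧
    ∀ ω : Matrix x x ℂ,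
      (N : ℂ)⁻¹ • ∑ d, U d * ω * (U d).conjTranspose = ω.trace • mixed x

/-- A family `h k : S → Fin N` of pairwise independent hash functions: for a uniformly random seed
`s : S` each value `h k s` is uniform, and two values `h k s`, `h k' s` with `k ≠ k'` are
independent. -/
def IsPairwiseIndependent {N : ℕ} (h : K → S → Fin N) : Prop :=
  (∀ k d, (Finset.univ.filter fun s => h k s = d).card * N = Fintype.card S) ∧
    ∀ k k', k ≠ k' → ∀ d d',
      (Finset.univ.filter fun s => h k s = d ∧ h k' s = d').card * N ^ 2 = Fintype.card S

/-- The unitaries `V_k = ∑_s U_{h_k(s)} ⊗ |s⟩⟨s|` on the tensor product of the system (basis `x`)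
and the seed register (basis `S`), for a 1-design `U` on the system and a family `h` of pairwise
independent hash functions from the seeds to the indices of the design. -/
def IsHashDesignFamily (V : K → Matrix (x × S) (x × S) ℂ) : Prop :=
  ∃ (N : ℕ) (U : Fin N → Matrix x x ℂ) (h : K → S → Fin N),
    IsOneDesign U ∧ IsPairwiseIndependent h ∧
      ∀ k, V k = ∑ s, U (h k s) ⊗ₖ Matrix.single s s (1 : ℂ)

/-- Index set of the fourfold tensor power of a Hilbert space with basis `x`. -/
abbrev Four (x : Type*) : Type _ := Fin 4 → x

/-- Rearrangement of the tensor factors `X Y M X'⁴ Y'⁴` into `X X'⁴ Y Y'⁴ M`. -/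
def rearrange (x y m : Type*) :
    (x × y × m) × (Four x × Four y) ≃ (x × Four x) × (y × Four y) × m where
  toFun p := ((p.1.1, p.2.1), (p.1.2.1, p.2.2), p.1.2.2)
  invFun q := ((q.1.1, q.2.1.1, q.2.2), (q.1.2, q.2.1.2))
  left_inv _ := rfl
  right_inv _ := rfl

/-- The operator `ω^{XYM} ⊗ μ^{X'⁴Y'⁴}`, on the factors in the order `X X'⁴ Y Y'⁴ M`. -/
def withCatalyst (ω : Matrix (x × y × m) (x × y × m) ℂ) :
    Matrix ((x × Four x) × (y × Four y) × m) ((x × Four x) × (y × Four y) × m) ℂ :=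
  Matrix.reindex (rearrange x y m) (rearrange x y m) (ω ⊗ₖ mixed (Four x × Four y))

/-- Convex split state
`(AB)⁻¹ ∑_{a,b} (V_a ⊗ W_b ⊗ 1) (ρ ⊗ μ) (V_a ⊗ W_b ⊗ 1)†`. -/
def convexSplitState {A B : ℕ} (V : Fin A → Matrix (x × Four x) (x × Four x) ℂ)
    (W : Fin B → Matrix (y × Four y) (y × Four y) ℂ)
    (ρ : Matrix (x × y × m) (x × y × m) ℂ) :
    Matrix ((x × Four x) × (y × Four y) × m) ((x × Four x) × (y × Four y) × m) ℂ :=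
  ((A : ℂ) * (B : ℂ))⁻¹ • ∑ a, ∑ b,
    (V a ⊗ₖ (W b ⊗ₖ (1 : Matrix m m ℂ))) * withCatalyst ρ *
      (V a ⊗ₖ (W b ⊗ₖ (1 : Matrix m m ℂ))).conjTranspose

/-- Fully decoupled state `μ^X ⊗ μ^Y ⊗ ρ^M ⊗ μ^{X'⁴Y'⁴}`. -/
def decoupledState (ρ : Matrix (x × y × m) (x × y × m) ℂ) :
    Matrix ((x × Four x) × (y × Four y) × m) ((x × Four x) × (y × Four y) × m) ℂ :=
  withCatalyst (mixed x ⊗ₖ (mixed y ⊗ₖ marginalM ρ))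

end ConvexSplit

end

open ConvexSplit

/-!
For a 1-design `U` on `X`, the twirl `T_X` (the average of all conjugations by the design) absorbs
conjugation by each design element: `T_X ∘ conj (U d) = T_X`.  The seed `s` selects the
subsample `A_X` of the twirl, the average over `a` of the conjugations by `U (h a s)`, and likewise
`A_Y` for a seed `t` on `Y`, so that everything reduces to bounding the trace norm of
`(A_X A_Y - T_X T_Y) ρ` on average over the seeds.

Up to the order of commuting factors,
`A_X A_Y - T_X T_Y = A_X A_Y (1 - T_X) (1 - T_Y) + T_Y A_X (1 - T_X) + T_X A_Y (1 - T_Y)`.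
In each term the conjugations act on an operator whose twirl vanishes.  By pairwise independence of
the hash functions the Hilbert-Schmidt cross terms between different conjugations then vanish on
average, so averaging over `K` of them shrinks the mean square of the `2`-norm by the factor `K`.
Cauchy-Schwarz with weight `μ ⊗ ρ^M`, which commutes with the design, converts this into
a trace norm bound governed by `D₂`.  Passing to the optimal smoothed operator costs `ε Tr ρ` in
trace norm for every twirl expanded, which gives the constants `4 + 2 + 2 = 8`.
-/

noncomputable section

namespace ConvexSplit

open Matrix
open scoped ComplexOrder

section TraceNorm

variable {n k o : Type*} [Fintype n] [DecidableEq n] [Fintype k] [DecidableEq k] [Fintype o]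
  [DecidableEq o]

omit [Fintype n] [DecidableEq n] in
theorem nonempty_of_ne_zero {M : Matrix n n ℂ} (hM : M ≠ 0) : Nonempty n :=
  not_isEmpty_iff.1 fun _ => hM (Subsingleton.elim M 0)

omit [DecidableEq n] in
theorem re_trace_nonneg {P : Matrix n n ℂ} (hP : P.PosSemidef) : 0 ≤ P.trace.re :=
  (Complex.le_def.1 hP.trace_nonneg).1

omit [DecidableEq n] in
theorem re_trace_pos {P : Matrix n n ℂ} (hP : P.PosSemidef) (hP0 : P ≠ 0) : 0 < P.trace.re := by
  refine (re_trace_nonneg hP).lt_of_ne fun h => hP0 (hP.trace_eq_zero_iff.1 ?_)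
  exact Complex.ext h.symm (Complex.le_def.1 hP.trace_nonneg).2.symm

omit [DecidableEq n] in
theorem ne_zero_of_re_trace_pos {P : Matrix n n ℂ} (hP : 0 < P.trace.re) : P ≠ 0 := by
  rintro rfl
  simp only [trace_zero, Complex.zero_re, lt_self_iff_false] at hP

section AbsoluteValue

open scoped MatrixOrder

theorem traceNorm_eq_re_trace_abs (M : Matrix n n ℂ) : traceNorm M = (CFC.abs M).trace.re := by
  rw [traceNorm, CFC.abs, CFC.sqrt_eq_real_sqrt _ (star_mul_self_nonneg M), cfcₙ_eq_cfc,
    star_eq_conjTranspose]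

theorem traceNorm_nonneg (M : Matrix n n ℂ) : 0 ≤ traceNorm M := by
  rw [traceNorm_eq_re_trace_abs]
  exact re_trace_nonneg (nonneg_iff_posSemidef.1 (CFC.abs_nonneg M))

theorem traceNorm_neg (M : Matrix n n ℂ) : traceNorm (-M) = traceNorm M := by
  simp only [traceNorm, conjTranspose_neg, neg_mul_neg]

theorem traceNorm_smul (c : ℂ) (M : Matrix n n ℂ) : traceNorm (c • M) = ‖c‖ * traceNorm M := by
  rw [traceNorm_eq_re_trace_abs, traceNorm_eq_re_trace_abs, CFC.abs_smul, trace_smul,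
    Complex.smul_re, smul_eq_mul]

theorem traceNorm_zero : traceNorm (0 : Matrix n n ℂ) = 0 := by
  simpa only [zero_smul, norm_zero, zero_mul] using traceNorm_smul 0 (0 : Matrix n n ℂ)

theorem exists_posSemidef_sub_eq {M : Matrix n n ℂ} (hM : M.IsHermitian) :
    ∃ P Q : Matrix n n ℂ, P.PosSemidef ∧ Q.PosSemidef ∧ M = P - Q ∧
      traceNorm M = P.trace.re + Q.trace.re := by
  have hM' : IsSelfAdjoint M := hM
  refine ⟨M⁺, M⁻, nonneg_iff_posSemidef.1 (CFC.posPart_nonneg M),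
    nonneg_iff_posSemidef.1 (CFC.negPart_nonneg M), (CFC.posPart_sub_negPart M).symm, ?_⟩
  rw [traceNorm_eq_re_trace_abs, ← CFC.posPart_add_negPart M, trace_add, Complex.add_re]

theorem exists_isHermitian_sign {M : Matrix n n ℂ} (hM : M.IsHermitian) :
    ∃ R : Matrix n n ℂ, R.IsHermitian ∧ R * R = 1 ∧ (R * M).trace.re = traceNorm M := by
  have hM' : IsSelfAdjoint M := hM
  have hcont (f : ℝ → ℝ) : ContinuousOn f (spectrum ℝ M) := M.finite_real_spectrum.continuousOn f
  let sign : ℝ → ℝ := fun t => if 0 ≤ t then 1 else -1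
  have sign_mul_self (t : ℝ) : sign t * sign t = 1 := by
    simp only [sign]; split_ifs <;> norm_num
  have sign_mul (t : ℝ) : sign t * t = |t| := by
    simp only [sign]
    split_ifs with ht
    · rw [one_mul, abs_of_nonneg ht]
    · rw [neg_one_mul, abs_of_neg (not_le.1 ht)]
  refine ⟨cfc sign M, cfc_predicate _ M, ?_, ?_⟩
  · rw [← cfc_mul _ _ M (hcont _) (hcont _)]
    simp only [sign_mul_self, cfc_const_one ℝ M]
  · rw [traceNorm_eq_re_trace_abs, CFC.abs_eq_cfc_norm M]
    nth_rewrite 2 [← cfc_id' ℝ M]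
    rw [← cfc_mul _ _ M (hcont _) (hcont _)]
    simp only [sign_mul, Real.norm_eq_abs]

end AbsoluteValue

theorem re_trace_mul_le_of_involutive {R P : Matrix n n ℂ} (hR : R.IsHermitian)
    (hRR : R * R = 1) (hP : P.PosSemidef) : (R * P).trace.re ≤ P.trace.re := by
  have hsq : (1 - R)ᴴ * (1 - R) = (2 : ℂ) • (1 - R) := by
    rw [conjTranspose_sub, conjTranspose_one, hR.eq, two_smul]
    simp only [sub_mul, mul_sub, hRR, one_mul, mul_one]
    abel
  have htrace : ((1 - R) * P * (1 - R)ᴴ).trace = 2 * (P.trace - (R * P).trace) := by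
    rw [trace_mul_comm, ← Matrix.mul_assoc, hsq, smul_mul_assoc, sub_mul, one_mul, trace_smul,
      trace_sub, smul_eq_mul]
  have hnonneg := re_trace_nonneg (hP.mul_mul_conjTranspose_same (1 - R))
  rw [htrace, ← Complex.ofReal_ofNat, Complex.re_ofReal_mul, Complex.sub_re] at hnonneg
  linarith

theorem traceNorm_sub_le_of_posSemidef {P Q : Matrix n n ℂ} (hP : P.PosSemidef)
    (hQ : Q.PosSemidef) : traceNorm (P - Q) ≤ P.trace.re + Q.trace.re := by
  obtain ⟨R, hR, hRR, hnorm⟩ := exists_isHermitian_sign (hP.isHermitian.sub hQ.isHermitian)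
  have hRP := re_trace_mul_le_of_involutive hR hRR hP
  have hRQ := re_trace_mul_le_of_involutive hR.neg (by rw [neg_mul_neg, hRR]) hQ
  rw [neg_mul, trace_neg, Complex.neg_re] at hRQ
  rw [← hnorm, mul_sub, trace_sub, Complex.sub_re]
  linarith

theorem traceNorm_add_le {M M' : Matrix n n ℂ} (hM : M.IsHermitian) (hM' : M'.IsHermitian) :
    traceNorm (M + M') ≤ traceNorm M + traceNorm M' := by
  obtain ⟨P, Q, hP, hQ, rfl, hnorm⟩ := exists_posSemidef_sub_eq hM
  obtain ⟨P', Q', hP', hQ', rfl, hnorm'⟩ := exists_posSemidef_sub_eq hM'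
  rw [hnorm, hnorm', sub_add_sub_comm]
  refine (traceNorm_sub_le_of_posSemidef (hP.add hP') (hQ.add hQ')).trans_eq ?_
  simp only [trace_add, Complex.add_re]
  ring

theorem traceNorm_sum_le {ι : Type*} (s : Finset ι) {M : ι → Matrix n n ℂ}
    (hM : ∀ i, (M i).IsHermitian) : traceNorm (∑ i ∈ s, M i) ≤ ∑ i ∈ s, traceNorm (M i) := by
  classical
  induction s using Finset.induction_on with
  | empty => simp only [Finset.sum_empty, traceNorm_zero, le_refl]
  | insert a s ha ih =>
    rw [Finset.sum_insert ha, Finset.sum_insert ha]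
    have hs : (∑ i ∈ s, M i).IsHermitian := isSelfAdjoint_sum s fun i _ => hM i
    exact (traceNorm_add_le (hM a) hs).trans (by gcongr)

theorem traceNorm_map_le_of_positive (φ : Matrix n n ℂ →ₗ[ℂ] Matrix k k ℂ)
    (hpos : ∀ P, P.PosSemidef → (φ P).PosSemidef)
    (htrace : ∀ P, P.PosSemidef → (φ P).trace.re ≤ P.trace.re)
    {M : Matrix n n ℂ} (hM : M.IsHermitian) : traceNorm (φ M) ≤ traceNorm M := by
  obtain ⟨P, Q, hP, hQ, rfl, hnorm⟩ := exists_posSemidef_sub_eq hM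
  rw [hnorm, map_sub]
  exact (traceNorm_sub_le_of_posSemidef (hpos P hP) (hpos Q hQ)).trans
    (add_le_add (htrace P hP) (htrace Q hQ))

theorem traceNorm_submatrix_equiv_le {M : Matrix n n ℂ} (hM : M.IsHermitian) (e : k ≃ n) :
    traceNorm (M.submatrix e e) ≤ traceNorm M :=
  traceNorm_map_le_of_positive (reindexLinearEquiv ℂ ℂ e.symm e.symm).toLinearMap
    (fun _ hP => hP.submatrix e)
    (fun P _ => (congrArg Complex.re (e.sum_comp fun i => P i i)).le) hM

omit [Fintype n] [DecidableEq n] [Fintype o] in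
theorem posSemidef_blockDiagonal [Finite n] [Finite o] {P : o → Matrix n n ℂ}
    (hP : ∀ r, (P r).PosSemidef) : (blockDiagonal P).PosSemidef := by
  classical
  cases nonempty_fintype n
  cases nonempty_fintype o
  open scoped MatrixOrder in
  choose C hC using fun r =>
    CStarAlgebra.nonneg_iff_eq_star_mul_self.1 (nonneg_iff_posSemidef.2 (hP r))
  simp only [star_eq_conjTranspose] at hC
  rw [funext hC, blockDiagonal_mul, ← blockDiagonal_conjTranspose]
  exact posSemidef_conjTranspose_mul_self _

theorem traceNorm_blockDiagonal_le {M : o → Matrix n n ℂ} (hM : ∀ r, (M r).IsHermitian) :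
    traceNorm (blockDiagonal M) ≤ ∑ r, traceNorm (M r) := by
  choose P Q hP hQ hPQ hnorm using fun r => exists_posSemidef_sub_eq (hM r)
  obtain rfl : M = P - Q := funext hPQ
  rw [blockDiagonal_sub]
  refine (traceNorm_sub_le_of_posSemidef (posSemidef_blockDiagonal hP)
    (posSemidef_blockDiagonal hQ)).trans_eq ?_
  simp only [trace_blockDiagonal, Complex.re_sum, hnorm, Finset.sum_add_distrib]

end TraceNorm

section HilbertSchmidt

variable {n : Type*} [Fintype n] [DecidableEq n]

/-- A matrix as a vector of the Euclidean space of its entries, which makes the matrices an inner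
product space with the Hilbert-Schmidt inner product. -/
def hsVec : Matrix n n ℂ →ₗ[ℂ] EuclideanSpace ℂ (n × n) where
  toFun M := WithLp.toLp 2 fun p => M p.1 p.2
  map_add' _ _ := rfl
  map_smul' _ _ := rfl

omit [DecidableEq n] in
theorem inner_hsVec (M M' : Matrix n n ℂ) : inner ℂ (hsVec M) (hsVec M') = (Mᴴ * M').trace := by
  rw [trace_mul_comm]
  simp only [PiLp.inner_apply, RCLike.inner_apply, trace, diag_apply, Matrix.mul_apply,
    conjTranspose_apply, Fintype.sum_prod_type]
  rfl

omit [DecidableEq n] in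
theorem norm_hsVec (M : Matrix n n ℂ) : ‖hsVec M‖ = schattenTwoNorm M := by
  rw [schattenTwoNorm, ← inner_hsVec, @norm_eq_sqrt_re_inner ℂ, RCLike.re_to_complex]

theorem schattenTwoNorm_isometry_mul {G : Matrix n n ℂ} (hG : Gᴴ * G = 1) (Z : Matrix n n ℂ) :
    schattenTwoNorm (G * Z) = schattenTwoNorm Z := by
  rw [schattenTwoNorm, conjTranspose_mul, Matrix.mul_assoc, ← Matrix.mul_assoc Gᴴ, hG, one_mul,
    schattenTwoNorm]

omit [DecidableEq n] in
theorem schattenTwoNorm_conjTranspose (Z : Matrix n n ℂ) :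
    schattenTwoNorm Zᴴ = schattenTwoNorm Z := by
  rw [schattenTwoNorm, conjTranspose_conjTranspose, trace_mul_comm, schattenTwoNorm]

theorem schattenTwoNorm_mul_conjTranspose {G : Matrix n n ℂ} (hG : Gᴴ * G = 1)
    (Z : Matrix n n ℂ) : schattenTwoNorm (Z * Gᴴ) = schattenTwoNorm Z := by
  rw [← schattenTwoNorm_conjTranspose, conjTranspose_mul, conjTranspose_conjTranspose,
    schattenTwoNorm_isometry_mul hG, schattenTwoNorm_conjTranspose]

omit [DecidableEq n] in
theorem re_trace_conjTranspose_mul_le (M M' : Matrix n n ℂ) :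
    (Mᴴ * M').trace.re ≤ schattenTwoNorm M * schattenTwoNorm M' := by
  rw [← inner_hsVec, ← norm_hsVec, ← norm_hsVec]
  exact (Complex.re_le_norm _).trans (norm_inner_le_norm _ _)

/-- The Cauchy-Schwarz inequality for `R * g ^ 2` and `g ^ 2 * R`, whose inner product is
`‖g R g‖₂²`. -/
theorem schattenTwoNorm_conj_involutive_le {g R : Matrix n n ℂ} (hg : g.IsHermitian)
    (hR : R.IsHermitian) (hRR : R * R = 1) :
    schattenTwoNorm (g * R * g) ≤ schattenTwoNorm (g * g) := by
  have hR' : Rᴴ * R = 1 := by rw [hR.eq, hRR]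
  have htrace : ((g * R * g)ᴴ * (g * R * g)).trace = ((R * (g * g))ᴴ * (g * g * Rᴴ)).trace := by
    simp only [conjTranspose_mul, hg.eq, hR.eq, Matrix.mul_assoc]
    rw [trace_mul_comm g]
    simp only [Matrix.mul_assoc]
    rw [trace_mul_comm R]
    simp only [Matrix.mul_assoc]
  rw [schattenTwoNorm, htrace]
  refine Real.sqrt_le_iff.2 ⟨Real.sqrt_nonneg _, (re_trace_conjTranspose_mul_le _ _).trans_eq ?_⟩
  rw [schattenTwoNorm_isometry_mul hR', schattenTwoNorm_mul_conjTranspose hR', sq]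

theorem traceNorm_conj_le {g Y : Matrix n n ℂ} (hg : g.IsHermitian) (hY : Y.IsHermitian) :
    traceNorm (g * Y * g) ≤ schattenTwoNorm (g * g) * schattenTwoNorm Y := by
  have hgYg : (g * Y * g).IsHermitian := by
    simpa only [hg.eq] using isHermitian_mul_mul_conjTranspose g hY
  obtain ⟨R, hR, hRR, hnorm⟩ := exists_isHermitian_sign hgYg
  have htrace : (R * (g * Y * g)).trace = ((g * R * g)ᴴ * Y).trace := by
    simp only [conjTranspose_mul, hg.eq, hR.eq, Matrix.mul_assoc]
    rw [← Matrix.mul_assoc R, ← Matrix.mul_assoc (R * g), trace_mul_comm]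
    simp only [Matrix.mul_assoc]
  rw [← hnorm, htrace]
  exact (re_trace_conjTranspose_mul_le _ _).trans (mul_le_mul_of_nonneg_right
    (schattenTwoNorm_conj_involutive_le hg hR hRR) (Real.sqrt_nonneg _))

end HilbertSchmidt

section Superoperators

variable {n ι : Type*} [Fintype n] [DecidableEq n] [Fintype ι]

/-- The superoperator `Z ↦ G Z G†`, multiplicative in `G`. -/
def conj : Matrix n n ℂ →* Module.End ℂ (Matrix n n ℂ) where
  toFun G := LinearMap.mulLeftRight ℂ (G, Gᴴ)
  map_one' := by ext Z : 1; simp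
  map_mul' G H := by
    ext Z : 1
    simp [Matrix.mul_assoc]

@[simp]
theorem conj_apply (G Z : Matrix n n ℂ) : conj G Z = G * Z * Gᴴ :=
  LinearMap.mulLeftRight_apply G Gᴴ Z

theorem isHermitian_conj (G : Matrix n n ℂ) {Z : Matrix n n ℂ} (hZ : Z.IsHermitian) :
    (conj G Z).IsHermitian := by
  rw [conj_apply]
  exact isHermitian_mul_mul_conjTranspose G hZ

theorem posSemidef_conj (G : Matrix n n ℂ) {P : Matrix n n ℂ} (hP : P.PosSemidef) :
    (conj G P).PosSemidef := by
  rw [conj_apply]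
  exact hP.mul_mul_conjTranspose_same G

theorem trace_conj {G : Matrix n n ℂ} (hG : G ∈ unitaryGroup n ℂ) (Z : Matrix n n ℂ) :
    (conj G Z).trace = Z.trace := by
  rw [conj_apply, trace_mul_comm, ← Matrix.mul_assoc, ← star_eq_conjTranspose,
    mem_unitaryGroup_iff'.1 hG, one_mul]

theorem schattenTwoNorm_conj {G : Matrix n n ℂ} (hG : G ∈ unitaryGroup n ℂ) (Z : Matrix n n ℂ) :
    schattenTwoNorm (conj G Z) = schattenTwoNorm Z := by
  have hGG : Gᴴ * G = 1 := mem_unitaryGroup_iff'.1 hG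
  rw [conj_apply, schattenTwoNorm_mul_conjTranspose hGG, schattenTwoNorm_isometry_mul hGG]

/-- The mixed unitary superoperator `Z ↦ |ι|⁻¹ ∑ᵢ Gᵢ Z Gᵢ†`. -/
def twirl (G : ι → Matrix n n ℂ) : Module.End ℂ (Matrix n n ℂ) :=
  (Fintype.card ι : ℂ)⁻¹ • ∑ i, conj (G i)

theorem twirl_apply (G : ι → Matrix n n ℂ) (Z : Matrix n n ℂ) :
    twirl G Z = (Fintype.card ι : ℂ)⁻¹ • ∑ i, conj (G i) Z := by
  rw [twirl, LinearMap.smul_apply, LinearMap.sum_apply]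

theorem twirl_mul_twirl {κ : Type*} [Fintype κ] (G : ι → Matrix n n ℂ) (H : κ → Matrix n n ℂ) :
    twirl G * twirl H = twirl fun p : ι × κ => G p.1 * H p.2 := by
  simp only [twirl, map_mul, Fintype.card_prod, Nat.cast_mul, mul_inv, smul_mul_smul_comm,
    Finset.sum_mul_sum, Fintype.sum_prod_type]

theorem commute_twirl {Φ : Module.End ℂ (Matrix n n ℂ)} {G : ι → Matrix n n ℂ}
    (hG : ∀ i, Commute Φ (conj (G i))) : Commute Φ (twirl G) :=
  (Commute.sum_right _ _ _ fun i _ => hG i).smul_right _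

/-- `L` preserves Hermiticity and is bounded by `c`, both in the trace norm on Hermitian matrices
and in the Hilbert-Schmidt norm. -/
structure IsBoundedBy (c : ℝ) (L : Module.End ℂ (Matrix n n ℂ)) : Prop where
  nonneg : 0 ≤ c
  isHermitian : ∀ {Z}, Z.IsHermitian → (L Z).IsHermitian
  traceNorm_le : ∀ {Z}, Z.IsHermitian → traceNorm (L Z) ≤ c * traceNorm Z
  schattenTwoNorm_le : ∀ Z, schattenTwoNorm (L Z) ≤ c * schattenTwoNorm Z

namespace IsBoundedBy

variable {c c' : ℝ} {L L' : Module.End ℂ (Matrix n n ℂ)}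

theorem one : IsBoundedBy 1 (1 : Module.End ℂ (Matrix n n ℂ)) where
  nonneg := zero_le_one
  isHermitian hZ := hZ
  traceNorm_le _ := (one_mul _).ge
  schattenTwoNorm_le _ := (one_mul _).ge

theorem sub (hL : IsBoundedBy c L) (hL' : IsBoundedBy c' L') : IsBoundedBy (c + c') (L - L') where
  nonneg := add_nonneg hL.nonneg hL'.nonneg
  isHermitian hZ := (hL.isHermitian hZ).sub (hL'.isHermitian hZ)
  traceNorm_le hZ := by
    rw [LinearMap.sub_apply, sub_eq_add_neg, add_mul]
    refine (traceNorm_add_le (hL.isHermitian hZ) (hL'.isHermitian hZ).neg).trans ?_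
    rw [traceNorm_neg]
    exact add_le_add (hL.traceNorm_le hZ) (hL'.traceNorm_le hZ)
  schattenTwoNorm_le Z := by
    have hle := hL.schattenTwoNorm_le Z
    have hle' := hL'.schattenTwoNorm_le Z
    simp only [← norm_hsVec] at hle hle' ⊢
    rw [LinearMap.sub_apply, map_sub, add_mul]
    exact (norm_sub_le _ _).trans (add_le_add hle hle')

theorem mul (hL : IsBoundedBy c L) (hL' : IsBoundedBy c' L') : IsBoundedBy (c * c') (L * L') where
  nonneg := mul_nonneg hL.nonneg hL'.nonneg
  isHermitian hZ := hL.isHermitian (hL'.isHermitian hZ)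
  traceNorm_le hZ := by
    rw [mul_assoc]
    exact (hL.traceNorm_le (hL'.isHermitian hZ)).trans
      (mul_le_mul_of_nonneg_left (hL'.traceNorm_le hZ) hL.nonneg)
  schattenTwoNorm_le Z := by
    rw [mul_assoc]
    exact (hL.schattenTwoNorm_le _).trans
      (mul_le_mul_of_nonneg_left (hL'.schattenTwoNorm_le Z) hL.nonneg)

end IsBoundedBy

section Twirl

variable {G : ι → Matrix n n ℂ}

theorem isHermitian_twirl (G : ι → Matrix n n ℂ) {Z : Matrix n n ℂ} (hZ : Z.IsHermitian) :
    (twirl G Z).IsHermitian := by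
  rw [twirl_apply]
  exact (IsSelfAdjoint.natCast (Fintype.card ι)).inv₀.smul
    (isSelfAdjoint_sum _ fun i _ => isHermitian_conj (G i) hZ)

theorem traceNorm_conj_unitary_le {G : Matrix n n ℂ} (hG : G ∈ unitaryGroup n ℂ)
    {Z : Matrix n n ℂ} (hZ : Z.IsHermitian) : traceNorm (conj G Z) ≤ traceNorm Z :=
  traceNorm_map_le_of_positive (conj G) (fun _ => posSemidef_conj G)
    (fun P _ => (congrArg Complex.re (trace_conj hG P)).le) hZ

theorem inv_card_mul_sum_le {f : ι → ℝ} {b : ℝ} (hb : 0 ≤ b) (hf : ∀ i, f i ≤ b) :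
    (Fintype.card ι : ℝ)⁻¹ * ∑ i, f i ≤ b := by
  refine inv_mul_le_of_le_mul₀ (Nat.cast_nonneg _) hb ?_
  simpa only [nsmul_eq_mul, Finset.card_univ] using
    Finset.sum_le_card_nsmul Finset.univ f b fun i _ => hf i

theorem isBoundedBy_twirl (hG : ∀ i, G i ∈ unitaryGroup n ℂ) : IsBoundedBy 1 (twirl G) where
  nonneg := zero_le_one
  isHermitian := isHermitian_twirl G
  traceNorm_le {Z} hZ := by
    rw [one_mul, twirl_apply, traceNorm_smul, norm_inv, Complex.norm_natCast]
    calc (Fintype.card ι : ℝ)⁻¹ * traceNorm (∑ i, conj (G i) Z)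
        ≤ (Fintype.card ι : ℝ)⁻¹ * ∑ i, traceNorm (conj (G i) Z) := by
          gcongr
          exact traceNorm_sum_le _ fun i => isHermitian_conj (G i) hZ
      _ ≤ traceNorm Z :=
          inv_card_mul_sum_le (traceNorm_nonneg Z) fun i => traceNorm_conj_unitary_le (hG i) hZ
  schattenTwoNorm_le Z := by
    rw [one_mul, twirl_apply, ← norm_hsVec, map_smul, norm_smul, norm_inv, Complex.norm_natCast,
      map_sum]
    calc (Fintype.card ι : ℝ)⁻¹ * ‖∑ i, hsVec (conj (G i) Z)‖
        ≤ (Fintype.card ι : ℝ)⁻¹ * ∑ i, ‖hsVec (conj (G i) Z)‖ := by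
          gcongr
          exact norm_sum_le _ _
      _ ≤ schattenTwoNorm Z := inv_card_mul_sum_le (Real.sqrt_nonneg _) fun i => by
          rw [norm_hsVec, schattenTwoNorm_conj (hG i)]

end Twirl

end Superoperators

section SecondMoment

variable {n K R : Type*} [Fintype n] [DecidableEq n] [Fintype K] [Fintype R]

theorem sum_norm_sq_of_pairwise_orthogonal {E : Type*} [NormedAddCommGroup E]
    [InnerProductSpace ℂ E] {v : K → R → E} {b : ℝ} (hb : ∀ k r, ‖v k r‖ = b)
    (horth : ∀ k k', k ≠ k' → ∑ r, inner ℂ (v k r) (v k' r) = 0) :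
    ∑ r, ‖∑ k, v k r‖ ^ 2 = Fintype.card R * Fintype.card K * b ^ 2 := by
  classical
  have hinner (k k' : K) :
      ∑ r, inner ℂ (v k r) (v k' r) = if k = k' then (Fintype.card R : ℂ) * (b : ℂ) ^ 2 else 0 := by
    split_ifs with hk
    · simp [← hk, inner_self_eq_norm_sq_to_K, hb]
    · exact horth k k' hk
  have hsum : (∑ r, (‖∑ k, v k r‖ : ℂ) ^ 2) = Fintype.card R * Fintype.card K * (b : ℂ) ^ 2 :=
    calc (∑ r, (‖∑ k, v k r‖ : ℂ) ^ 2) = ∑ r, inner ℂ (∑ k, v k r) (∑ k, v k r) := by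
          simp only [inner_self_eq_norm_sq_to_K]
          rfl
      _ = ∑ k', ∑ k, ∑ r, inner ℂ (v k r) (v k' r) := by
          simp only [sum_inner, inner_sum]
          rw [Finset.sum_comm]
          exact Finset.sum_congr rfl fun k' _ => Finset.sum_comm
      _ = Fintype.card R * Fintype.card K * (b : ℂ) ^ 2 := by
          simp only [hinner, Finset.sum_ite_eq', Finset.mem_univ, if_true, Finset.sum_const,
            Finset.card_univ, nsmul_eq_mul]
          ring
  exact_mod_cast hsum

theorem sum_schattenTwoNorm_twirl_le {G : K → R → Matrix n n ℂ}
    (hG : ∀ k r, G k r ∈ unitaryGroup n ℂ) {Z : Matrix n n ℂ}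
    (horth : ∀ k k', k ≠ k' →
      ∑ r, inner ℂ (hsVec (conj (G k r) Z)) (hsVec (conj (G k' r) Z)) = 0) :
    ∑ r, schattenTwoNorm (twirl (G · r) Z)
      ≤ Fintype.card R * (schattenTwoNorm Z / √(Fintype.card K)) := by
  have hsum : ∑ r, ‖∑ k, hsVec (conj (G k r) Z)‖ ^ 2
      = Fintype.card R * Fintype.card K * schattenTwoNorm Z ^ 2 :=
    sum_norm_sq_of_pairwise_orthogonal
      (fun k r => by rw [norm_hsVec, schattenTwoNorm_conj (hG k r)]) horth
  have hsum_twirl : ∑ r, schattenTwoNorm (twirl (G · r) Z) ^ 2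
      = Fintype.card R * (schattenTwoNorm Z / √(Fintype.card K)) ^ 2 := by
    simp only [twirl_apply, ← norm_hsVec, map_smul, map_sum, norm_smul, mul_pow, ← Finset.mul_sum,
      norm_inv, Complex.norm_natCast] at hsum ⊢
    rw [hsum, div_pow, Real.sq_sqrt (Nat.cast_nonneg _)]
    rcases eq_or_ne (Fintype.card K : ℝ) 0 with h0 | h0
    · simp [h0]
    · field_simp
  refine le_of_sq_le_sq ?_ (mul_nonneg (Nat.cast_nonneg _)
    (div_nonneg (Real.sqrt_nonneg _) (Real.sqrt_nonneg _)))
  calc (∑ r, schattenTwoNorm (twirl (G · r) Z)) ^ 2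
      ≤ Fintype.card R * ∑ r, schattenTwoNorm (twirl (G · r) Z) ^ 2 := sq_sum_le_card_mul_sum_sq
    _ = (Fintype.card R * (schattenTwoNorm Z / √(Fintype.card K))) ^ 2 := by
        rw [hsum_twirl]
        ring

/-- Splitting `ρ = (ρ - g Z g) + g Z g`: the first part is small in trace norm, while on the second
the map `A * L` acts on `Z` alone, whose image can be estimated in the Hilbert-Schmidt norm. -/
theorem traceNorm_mul_apply_le {g : Matrix n n ℂ} (hg : g.IsHermitian) {c δ : ℝ}
    {A L : Module.End ℂ (Matrix n n ℂ)} (hA : IsBoundedBy 1 A) (hL : IsBoundedBy c L)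
    (hgA : Commute (conj g) A) (hgL : Commute (conj g) L) {ρ Z : Matrix n n ℂ}
    (hρ : ρ.IsHermitian) (hZ : Z.IsHermitian) (hδ : traceNorm (conj g Z - ρ) ≤ δ) :
    traceNorm (A (L ρ))
      ≤ c * δ + schattenTwoNorm (g * g) * schattenTwoNorm (A (L Z)) := by
  have hAL : IsBoundedBy c (A * L) := by simpa only [one_mul] using hA.mul hL
  have hD : (ρ - conj g Z).IsHermitian := hρ.sub (isHermitian_conj g hZ)
  have hALZ : ((A * L) Z).IsHermitian := hAL.isHermitian hZ
  have hsplit : (A * L) ρ = (A * L) (ρ - conj g Z) + conj g ((A * L) Z) := by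
    rw [← Module.End.mul_apply (conj g), (hgA.mul_right hgL).eq, Module.End.mul_apply (A * L),
      ← map_add, sub_add_cancel]
  rw [← Module.End.mul_apply, ← Module.End.mul_apply, hsplit]
  refine (traceNorm_add_le (hAL.isHermitian hD) (isHermitian_conj g hALZ)).trans (add_le_add ?_ ?_)
  · refine (hAL.traceNorm_le hD).trans (mul_le_mul_of_nonneg_left ?_ hL.nonneg)
    rwa [← traceNorm_neg, neg_sub]
  · rw [conj_apply, hg.eq]
    exact traceNorm_conj_le hg hALZ

theorem sum_traceNorm_twirl_le {g : Matrix n n ℂ} (hg : g.IsHermitian) {c δ : ℝ}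
    {L : Module.End ℂ (Matrix n n ℂ)} (hL : IsBoundedBy c L) (hgL : Commute (conj g) L)
    {G : K → R → Matrix n n ℂ} (hG : ∀ k r, G k r ∈ unitaryGroup n ℂ)
    (hgG : ∀ k r, Commute g (G k r)) {ρ Z : Matrix n n ℂ} (hρ : ρ.IsHermitian)
    (hZ : Z.IsHermitian) (hδ : traceNorm (conj g Z - ρ) ≤ δ)
    (horth : ∀ k k', k ≠ k' →
      ∑ r, inner ℂ (hsVec (conj (G k r) (L Z))) (hsVec (conj (G k' r) (L Z))) = 0) :
    ∑ r, traceNorm (twirl (G · r) (L ρ))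
      ≤ Fintype.card R * (c * δ + schattenTwoNorm (g * g)
          * (c * schattenTwoNorm Z / √(Fintype.card K))) :=
  calc ∑ r, traceNorm (twirl (G · r) (L ρ))
      ≤ ∑ r, (c * δ + schattenTwoNorm (g * g) * schattenTwoNorm (twirl (G · r) (L Z))) :=
        Finset.sum_le_sum fun r _ => traceNorm_mul_apply_le hg (isBoundedBy_twirl (hG · r)) hL
          (commute_twirl fun k => (hgG k r).map conj) hgL hρ hZ hδ
    _ = Fintype.card R * (c * δ)
          + schattenTwoNorm (g * g) * ∑ r, schattenTwoNorm (twirl (G · r) (L Z)) := by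
        rw [Finset.sum_add_distrib, Finset.sum_const, Finset.card_univ, nsmul_eq_mul,
          Finset.mul_sum]
    _ ≤ Fintype.card R * (c * δ) + schattenTwoNorm (g * g)
          * (Fintype.card R * (c * schattenTwoNorm Z / √(Fintype.card K))) := by
        gcongr
        · exact Real.sqrt_nonneg _
        · refine (sum_schattenTwoNorm_twirl_le hG horth).trans ?_
          gcongr
          exact hL.schattenTwoNorm_le Z
    _ = Fintype.card R * (c * δ + schattenTwoNorm (g * g)
          * (c * schattenTwoNorm Z / √(Fintype.card K))) := by ring

end SecondMoment

section PairwiseIndependence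

variable {K S : Type*} [Fintype S] {N : ℕ} {h : K → S → Fin N}

theorem sum_comp_eq_sum_card_smul {M D : Type*} [AddCommMonoid M] [Fintype D] [DecidableEq D]
    (e : S → D) (f : D → M) :
    ∑ s, f (e s) = ∑ d, (Finset.univ.filter fun s => e s = d).card • f d := by
  simp only [← Finset.sum_fiberwise' Finset.univ e f, Finset.sum_const]

theorem IsPairwiseIndependent.sq_smul_sum {M : Type*} [AddCommMonoid M]
    (hh : IsPairwiseIndependent h) {k k' : K} (hk : k ≠ k') (f : Fin N → Fin N → M) :
    N ^ 2 • ∑ s, f (h k s) (h k' s) = Fintype.card S • ∑ d, ∑ d', f d d' := by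
  rw [sum_comp_eq_sum_card_smul (fun s => (h k s, h k' s)) fun p => f p.1 p.2,
    Fintype.sum_prod_type, Finset.smul_sum, Finset.smul_sum]
  refine Finset.sum_congr rfl fun d _ => ?_
  rw [Finset.smul_sum, Finset.smul_sum]
  refine Finset.sum_congr rfl fun d' _ => ?_
  simp only [Prod.mk.injEq]
  rw [smul_smul, mul_comm, hh.2 k k' hk d d']

theorem IsPairwiseIndependent.sum_inner_eq_zero {E : Type*} [NormedAddCommGroup E]
    [InnerProductSpace ℂ E] (hh : IsPairwiseIndependent h) {k k' : K} (hk : k ≠ k')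
    {v : Fin N → E} (hv : ∑ d, v d = 0) (v' : Fin N → E) :
    ∑ s, inner ℂ (v (h k s)) (v' (h k' s)) = 0 := by
  rcases isEmpty_or_nonempty S with hS | ⟨⟨s₀⟩⟩
  · exact Fintype.sum_empty _
  have hN : N ^ 2 ≠ 0 := pow_ne_zero 2 (Nat.ne_of_gt (h k s₀).pos)
  refine (smul_eq_zero_iff_right hN).1 ?_
  rw [hh.sq_smul_sum hk fun d d' => inner ℂ (v d) (v' d'), Finset.sum_comm]
  simp only [← sum_inner, hv, inner_zero_left, Finset.sum_const_zero, smul_zero]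

end PairwiseIndependence

section RenyiDivergence

variable {n : Type*} [Fintype n] [DecidableEq n]

theorem isHermitian_psdPow (β : Matrix n n ℂ) (s : ℝ) : (psdPow β s).IsHermitian :=
  cfc_predicate (R := ℝ) _ β

theorem commute_psdPow {G β : Matrix n n ℂ} (hβ : β.IsHermitian) (h : Commute G β) (s : ℝ) :
    Commute (psdPow β s) G :=
  hβ.isSelfAdjoint.commute_cfc h.symm _

theorem nonneg_of_mem_spectrum {β : Matrix n n ℂ} (hβ : β.PosSemidef) {t : ℝ}
    (ht : t ∈ spectrum ℝ β) : 0 ≤ t := by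
  open scoped MatrixOrder in
  exact spectrum_nonneg_of_nonneg (nonneg_iff_posSemidef.2 hβ) ht

theorem psdPow_inv_pow {β : Matrix n n ℂ} (hβ : β.PosSemidef) {k : ℕ} (hk : k ≠ 0) :
    psdPow β (k : ℝ)⁻¹ ^ k = β := by
  have hsa : IsSelfAdjoint β := hβ.isHermitian
  rw [psdPow, ← cfc_pow _ k β (β.finite_real_spectrum.continuousOn _)]
  conv_rhs => rw [← cfc_id' ℝ β]
  exact cfc_congr fun t ht => Real.rpow_inv_natCast_pow (nonneg_of_mem_spectrum hβ ht) hk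

theorem psdPow_mul_psdPow_neg_mul {β : Matrix n n ℂ} (hβ : β.PosSemidef) (s : ℝ) :
    psdPow β s * psdPow β (-s) * β = β := by
  have hsa : IsSelfAdjoint β := hβ.isHermitian
  have hcont (f : ℝ → ℝ) : ContinuousOn f (spectrum ℝ β) := β.finite_real_spectrum.continuousOn f
  have hcfc : psdPow β s * psdPow β (-s) * cfc (fun t : ℝ => t) β = cfc (fun t : ℝ => t) β := by
    rw [psdPow, psdPow, ← cfc_mul _ _ β (hcont _) (hcont _), ← cfc_mul _ _ β (hcont _) (hcont _)]
    refine cfc_congr fun t ht => ?_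
    rcases (nonneg_of_mem_spectrum hβ ht).eq_or_lt with rfl | ht0
    · simp
    · simp [← Real.rpow_add ht0]
  rwa [cfc_id' ℝ β] at hcfc

omit [DecidableEq n] in
theorem mul_eq_self_of_support_le {P α β : Matrix n n ℂ} (hαβ : support α ≤ support β)
    (hP : P * β = β) : P * α = α := by
  classical
  refine ext_of_mulVec_single fun i => ?_
  obtain ⟨w, hw⟩ := hαβ ⟨Pi.single i 1, rfl⟩
  simp only [mulVecLin_apply] at hw
  rw [← mulVec_mulVec, ← hw, mulVec_mulVec, hP]

theorem conj_psdPow_conj_psdPow_neg {α β : Matrix n n ℂ} (hα : α.IsHermitian) (hβ : β.PosSemidef)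
    (hαβ : support α ≤ support β) (s : ℝ) :
    conj (psdPow β s) (conj (psdPow β (-s)) α) = α := by
  have hPα : psdPow β s * psdPow β (-s) * α = α :=
    mul_eq_self_of_support_le hαβ (psdPow_mul_psdPow_neg_mul hβ s)
  have hαP : α * (psdPow β s * psdPow β (-s))ᴴ = α := by
    simpa only [conjTranspose_mul, hα.eq] using congrArg conjTranspose hPα
  rw [← Module.End.mul_apply, ← map_mul, conj_apply, hPα, hαP]

theorem schattenTwoNorm_psdPow_quarter_mul_self {β : Matrix n n ℂ} (hβ : β.PosSemidef) :
    schattenTwoNorm (psdPow β (1 / 4) * psdPow β (1 / 4)) = √β.trace.re := by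
  have hpow : psdPow β (1 / 4) ^ 4 = β := by
    simpa only [one_div, Nat.cast_ofNat] using psdPow_inv_pow hβ four_ne_zero
  rw [schattenTwoNorm, conjTranspose_mul, (isHermitian_psdPow β _).eq, ← sq, ← sq, ← pow_mul, hpow]

theorem log2_of_pos {r : ℝ} (hr : 0 < r) : log2 r = ((Real.logb 2 r : ℝ) : EReal) :=
  if_neg (not_le.2 hr)

theorem pos_of_lt_log2 {r : EReal} {k : ℕ} (h : r < log2 k) : 0 < k := by
  refine Nat.pos_of_ne_zero fun hk => not_lt_bot (a := r) ?_
  rwa [hk, Nat.cast_zero, log2, if_pos le_rfl] at h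

theorem log2_mul {r s : ℝ} (hr : 0 < r) (hs : 0 < s) : log2 (r * s) = log2 r + log2 s := by
  rw [log2_of_pos hr, log2_of_pos hs, log2_of_pos (mul_pos hr hs),
    Real.logb_mul hr.ne' hs.ne', EReal.coe_add]

theorem lt_sqrt_mul_sqrt_of_two_mul_log2_lt {r c k : ℝ} (hc : 0 < c) (hk : 0 < k)
    (h : 2 * log2 r + log2 c⁻¹ < log2 k) : r < √c * √k := by
  rcases le_or_gt r 0 with hr | hr
  · exact hr.trans_lt (mul_pos (Real.sqrt_pos.2 hc) (Real.sqrt_pos.2 hk))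
  rw [log2_of_pos hr, log2_of_pos (inv_pos.2 hc), log2_of_pos hk] at h
  change ((2 : ℝ) : EReal) * _ + _ < _ at h
  have hlogb : 2 * Real.logb 2 r + Real.logb 2 c⁻¹ < Real.logb 2 k := by exact_mod_cast h
  rw [two_mul, ← Real.logb_mul hr.ne' hr.ne',
    ← Real.logb_mul (mul_pos hr hr).ne' (inv_ne_zero hc.ne'),
    Real.logb_lt_logb_iff one_lt_two (by positivity) hk, mul_inv_lt_iff₀ hc, ← sq] at hlogb
  rw [← Real.sqrt_mul hc.le, mul_comm c k]
  exact Real.lt_sqrt_of_sq_lt hlogb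

theorem exists_of_smoothRenyiTwo_add_lt {ε c k : ℝ} {α β : Matrix n n ℂ} (hc : 0 < c) (hk : 0 < k)
    (h : smoothRenyiTwo ε α β + log2 c⁻¹ < log2 k) :
    ∃ α' : Matrix n n ℂ, α'.IsHermitian ∧ traceNorm (α' - α) ≤ ε * α.trace.re ∧
      support α' ≤ support β ∧ schattenTwoNorm (conj (psdPow β (-(1 / 4))) α') < √c * √k := by
  have hlog_c : log2 c⁻¹ = ((Real.logb 2 c⁻¹ : ℝ) : EReal) := log2_of_pos (inv_pos.2 hc)
  have hlt : smoothRenyiTwo ε α β < log2 k - log2 c⁻¹ := by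
    rwa [EReal.lt_sub_iff_add_lt (by simp [hlog_c]) (by simp [hlog_c])]
  simp only [smoothRenyiTwo, iInf_lt_iff] at hlt
  obtain ⟨α', ⟨⟨hα', -⟩, hclose⟩, hlt⟩ := hlt
  have hsupp : support α' ≤ support β := by
    by_contra hsupp
    simp [renyiTwo, hsupp] at hlt
  rw [EReal.lt_sub_iff_add_lt (by simp [hlog_c]) (by simp [hlog_c]), renyiTwo, if_pos hsupp] at hlt
  refine ⟨α', hα'.isHermitian, hclose, hsupp, ?_⟩
  rw [conj_apply, (isHermitian_psdPow β _).eq]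
  exact lt_sqrt_mul_sqrt_of_two_mul_log2_lt hc hk hlt

end RenyiDivergence

section SmoothDecoupling

variable {n K R : Type*} [Fintype n] [DecidableEq n] [Fintype K] [Nonempty K] [Fintype R]
  [Nonempty R]

theorem sum_traceNorm_twirl_lt {ρ β : Matrix n n ℂ} (hρ : ρ.IsHermitian) (hβ : β.PosSemidef)
    (hβ0 : β ≠ 0) {C : ℝ} (hC : 0 < C) {L : Module.End ℂ (Matrix n n ℂ)} (hL : IsBoundedBy C L)
    (hβL : Commute (conj (psdPow β (1 / 4))) L) {G : K → R → Matrix n n ℂ}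
    (hG : ∀ k r, G k r ∈ unitaryGroup n ℂ) (hGβ : ∀ k r, Commute (G k r) β)
    (horth : ∀ Z k k', k ≠ k' →
      ∑ r, inner ℂ (hsVec (conj (G k r) (L Z))) (hsVec (conj (G k' r) (L Z))) = 0)
    {ε c : ℝ} (hc : 0 < c) (h : smoothRenyiTwo ε ρ β + log2 c⁻¹ < log2 (Fintype.card K)) :
    ∑ r, traceNorm (twirl (G · r) (L ρ))
      < Fintype.card R * (C * (ε * ρ.trace.re + √β.trace.re * √c)) := by
  have hK : (0 : ℝ) < Fintype.card K := Nat.cast_pos.2 Fintype.card_pos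
  obtain ⟨α, hα, hclose, hsupp, hlt⟩ := exists_of_smoothRenyiTwo_add_lt hc hK h
  refine (sum_traceNorm_twirl_le (δ := ε * ρ.trace.re) (isHermitian_psdPow β _) hL hβL hG
    (fun k r => commute_psdPow hβ.isHermitian (hGβ k r) _) hρ (isHermitian_conj _ hα)
    (by rwa [conj_psdPow_conj_psdPow_neg hα hβ hsupp]) (horth _)).trans_lt ?_
  rw [schattenTwoNorm_psdPow_quarter_mul_self hβ, mul_div_assoc, mul_left_comm _ C,
    ← mul_add]
  have hβ_pos : 0 < √β.trace.re := Real.sqrt_pos.2 (re_trace_pos hβ hβ0)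
  gcongr
  rwa [div_lt_iff₀ (Real.sqrt_pos.2 hK)]

end SmoothDecoupling

section TwirlingDesigns

variable {n D D' K K' : Type*} [Fintype n] [DecidableEq n] [Fintype D] [Fintype D'] [Fintype K]
  [Nonempty K] [Fintype K'] [Nonempty K']

/-- A family of unitaries whose twirl absorbs the conjugation by each of them, as a 1-design acting
on one factor of a tensor product does. -/
structure IsTwirlingDesign (E : D → Matrix n n ℂ) : Prop where
  mem_unitaryGroup : ∀ d, E d ∈ unitaryGroup n ℂ
  conj_mul_twirl : ∀ d, conj (E d) * twirl E = twirl E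

omit [Fintype D] [Fintype D'] [Nonempty K] [Nonempty K'] in
theorem commute_twirl_twirl {E : D → Matrix n n ℂ} {F : D' → Matrix n n ℂ}
    (hEF : ∀ d d', Commute (E d) (F d')) (f : K → D) (f' : K' → D') :
    Commute (twirl fun k => E (f k)) (twirl fun k => F (f' k)) :=
  commute_twirl fun k' => (commute_twirl fun k => ((hEF (f k) (f' k')).map conj).symm).symm

namespace IsTwirlingDesign

variable {E : D → Matrix n n ℂ} {F : D' → Matrix n n ℂ}

theorem twirl_comp_mul_twirl (hE : IsTwirlingDesign E) (f : K → D) :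
    twirl (fun k => E (f k)) * twirl E = twirl E := by
  have hK : (Fintype.card K : ℂ) ≠ 0 := Nat.cast_ne_zero.2 Fintype.card_ne_zero
  rw [twirl, smul_mul_assoc, Finset.sum_mul,
    Finset.sum_congr rfl fun k _ => hE.conj_mul_twirl (f k),
    Finset.sum_const, Finset.card_univ, ← Nat.cast_smul_eq_nsmul ℂ, inv_smul_smul₀ hK]

theorem sum_conj_mul_one_sub_twirl (hE : IsTwirlingDesign E) :
    ∑ d, conj (E d) * (1 - twirl E) = 0 := by
  rcases isEmpty_or_nonempty D with hD | hD
  · exact Fintype.sum_empty _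
  have hD0 : (Fintype.card D : ℂ) ≠ 0 := Nat.cast_ne_zero.2 Fintype.card_ne_zero
  have hmul : twirl E * (1 - twirl E) = 0 := by
    rw [mul_sub, mul_one, hE.twirl_comp_mul_twirl fun d => d, sub_self]
  rw [← Finset.sum_mul, ← smul_right_injective _ (inv_ne_zero hD0) |>.eq_iff, smul_zero]
  rwa [twirl, smul_mul_assoc] at hmul

theorem isBoundedBy_one_sub_twirl (hE : IsTwirlingDesign E) : IsBoundedBy 2 (1 - twirl E) :=
  one_add_one_eq_two (R := ℝ) ▸ IsBoundedBy.one.sub (isBoundedBy_twirl hE.mem_unitaryGroup)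

theorem twirl_mul_twirl_sub_eq (hE : IsTwirlingDesign E) (hF : IsTwirlingDesign F)
    (hEF : ∀ d d', Commute (E d) (F d')) (f : K → D) (f' : K' → D') :
    twirl (fun k => E (f k)) * twirl (fun k => F (f' k)) - twirl E * twirl F
      = twirl (fun k => E (f k)) * twirl (fun k => F (f' k)) * ((1 - twirl E) * (1 - twirl F))
        + twirl F * (twirl (fun k => E (f k)) * (1 - twirl E))
        + twirl E * (twirl (fun k => F (f' k)) * (1 - twirl F)) := by
  have hcommE : Commute (twirl fun k' => F (f' k')) (1 - twirl E) :=
    (Commute.one_right _).sub_right (commute_twirl_twirl hEF (fun d => d) f').symm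
  have hcommF : Commute (twirl F) (twirl (fun k => E (f k)) * (1 - twirl E)) :=
    (commute_twirl_twirl hEF f fun d' => d').symm.mul_right
      ((Commute.one_right _).sub_right (commute_twirl_twirl hEF (fun d => d) fun d' => d').symm)
  rw [hcommF.eq, mul_assoc (twirl _), hcommE.left_comm, ← mul_assoc, mul_sub, mul_sub, mul_one,
    mul_one, hE.twirl_comp_mul_twirl, hF.twirl_comp_mul_twirl]
  simp only [sub_mul, mul_sub]
  abel

end IsTwirlingDesign

section Decoupling

variable {S T : Type*} [Fintype S] [Nonempty S] [Fintype T] [Nonempty T] {N N' : ℕ}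
  {E : Fin N → Matrix n n ℂ} {F : Fin N' → Matrix n n ℂ} {h : K → S → Fin N} {h' : K' → T → Fin N'}
  {ρ β : Matrix n n ℂ} {ε c : ℝ}

theorem commute_conj_psdPow_twirl {E : D → Matrix n n ℂ} (hβ : β.IsHermitian)
    (hEβ : ∀ d, Commute (E d) β) (s : ℝ) : Commute (conj (psdPow β s)) (twirl E) :=
  commute_twirl fun d => (commute_psdPow hβ (hEβ d) s).map conj

theorem sum_traceNorm_twirl_one_sub_twirl_lt (hE : IsTwirlingDesign E)
    (hh : IsPairwiseIndependent h) (hρ : ρ.IsHermitian) (hβ : β.PosSemidef) (hβ0 : β ≠ 0)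
    (hEβ : ∀ d, Commute (E d) β) (hc : 0 < c)
    (hlt : smoothRenyiTwo ε ρ β + log2 c⁻¹ < log2 (Fintype.card K)) :
    ∑ s, traceNorm (twirl (fun k => E (h k s)) ((1 - twirl E) ρ))
      < Fintype.card S * (2 * (ε * ρ.trace.re + √β.trace.re * √c)) := by
  refine sum_traceNorm_twirl_lt hρ hβ hβ0 two_pos hE.isBoundedBy_one_sub_twirl
    ((Commute.one_right _).sub_right (commute_conj_psdPow_twirl hβ.isHermitian hEβ _))
    (fun k s => hE.mem_unitaryGroup (h k s)) (fun k s => hEβ (h k s)) (fun Z k k' hk => ?_) hc hlt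
  refine hh.sum_inner_eq_zero hk (v := fun d => hsVec (conj (E d) _)) ?_
    fun d => hsVec (conj (E d) _)
  simp only [← Module.End.mul_apply, ← map_sum, ← LinearMap.sum_apply,
    hE.sum_conj_mul_one_sub_twirl, LinearMap.zero_apply, map_zero]

omit [Fintype K] [Nonempty K] [Fintype K'] [Nonempty K'] [Nonempty S] [Nonempty T] in
theorem sum_inner_conj_mul_eq_zero (hE : IsTwirlingDesign E) (hF : IsTwirlingDesign F)
    (hEF : ∀ d d', Commute (E d) (F d')) (hh : IsPairwiseIndependent h)
    (hh' : IsPairwiseIndependent h') {k k' : K × K'} (hk : k ≠ k') (Z : Matrix n n ℂ) :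
    ∑ r : S × T,
      inner ℂ (hsVec (conj (E (h k.1 r.1) * F (h' k.2 r.2)) (((1 - twirl E) * (1 - twirl F)) Z)))
        (hsVec (conj (E (h k'.1 r.1) * F (h' k'.2 r.2)) (((1 - twirl E) * (1 - twirl F)) Z)))
      = 0 := by
  have hcomm : (1 - twirl E) * (1 - twirl F) = (1 - twirl F) * (1 - twirl E) :=
    ((Commute.one_left _).sub_left ((Commute.one_right _).sub_right
      (commute_twirl_twirl hEF (fun d => d) fun d' => d'))).eq
  have hsumE (d') : ∑ d, conj (E d * F d') * ((1 - twirl E) * (1 - twirl F)) = 0 := by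
    simp only [(hEF _ d').eq, map_mul, mul_assoc, ← Finset.mul_sum]
    simp only [← mul_assoc, ← Finset.sum_mul, hE.sum_conj_mul_one_sub_twirl, zero_mul,
      mul_zero]
  have hsumF (d) : ∑ d', conj (E d * F d') * ((1 - twirl E) * (1 - twirl F)) = 0 := by
    simp only [hcomm, map_mul, mul_assoc, ← Finset.mul_sum]
    simp only [← mul_assoc, ← Finset.sum_mul, hF.sum_conj_mul_one_sub_twirl, zero_mul,
      mul_zero]
  rw [Fintype.sum_prod_type]
  by_cases ha : k.1 = k'.1
  · have hb : k.2 ≠ k'.2 := fun hb => hk (Prod.ext ha hb)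
    refine Finset.sum_eq_zero fun s _ => hh'.sum_inner_eq_zero hb
      (v := fun d' => hsVec (conj (E (h k.1 s) * F d') _)) ?_
      fun d' => hsVec (conj (E (h k'.1 s) * F d') _)
    simp only [← Module.End.mul_apply, ← map_sum, ← LinearMap.sum_apply, hsumF,
      LinearMap.zero_apply, map_zero]
  · rw [Finset.sum_comm]
    refine Finset.sum_eq_zero fun t _ => hh.sum_inner_eq_zero ha
      (v := fun d => hsVec (conj (E d * F (h' k.2 t)) _)) ?_
      fun d => hsVec (conj (E d * F (h' k'.2 t)) _)
    simp only [← Module.End.mul_apply, ← map_sum, ← LinearMap.sum_apply, hsumE,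
      LinearMap.zero_apply, map_zero]

theorem sum_traceNorm_twirl_twirl_lt (hE : IsTwirlingDesign E) (hF : IsTwirlingDesign F)
    (hEF : ∀ d d', Commute (E d) (F d')) (hh : IsPairwiseIndependent h)
    (hh' : IsPairwiseIndependent h') (hρ : ρ.IsHermitian) (hβ : β.PosSemidef) (hβ0 : β ≠ 0)
    (hEβ : ∀ d, Commute (E d) β) (hFβ : ∀ d, Commute (F d) β) (hc : 0 < c)
    (hlt : smoothRenyiTwo ε ρ β + log2 c⁻¹ < log2 (Fintype.card (K × K'))) :
    ∑ r : S × T, traceNorm ((twirl (fun k => E (h k r.1)) * twirl fun k => F (h' k r.2))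
        (((1 - twirl E) * (1 - twirl F)) ρ))
      < Fintype.card (S × T) * (4 * (ε * ρ.trace.re + √β.trace.re * √c)) := by
  have hL : IsBoundedBy 4 ((1 - twirl E) * (1 - twirl F)) := by
    rw [← two_add_two_eq_four, ← two_mul]
    exact hE.isBoundedBy_one_sub_twirl.mul hF.isBoundedBy_one_sub_twirl
  have hβL : Commute (conj (psdPow β (1 / 4))) ((1 - twirl E) * (1 - twirl F)) :=
    ((Commute.one_right _).sub_right
      (commute_conj_psdPow_twirl hβ.isHermitian hEβ _)).mul_right
        ((Commute.one_right _).sub_right (commute_conj_psdPow_twirl hβ.isHermitian hFβ _))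
  have horth (Z) (k k' : K × K') (hk : k ≠ k') :=
    sum_inner_conj_mul_eq_zero hE hF hEF hh hh' hk Z
  simp only [twirl_mul_twirl]
  exact sum_traceNorm_twirl_lt (G := fun (k : K × K') (r : S × T) => E (h k.1 r.1) * F (h' k.2 r.2))
    hρ hβ hβ0 four_pos hL hβL
    (fun k r => mul_mem (hE.mem_unitaryGroup (h k.1 r.1)) (hF.mem_unitaryGroup (h' k.2 r.2)))
    (fun k r => (hEβ (h k.1 r.1)).mul_left (hFβ (h' k.2 r.2))) horth hc hlt

end Decoupling

end TwirlingDesigns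

section TensorFactors

variable {x z D : Type*} [Fintype x] [DecidableEq x] [Fintype z] [DecidableEq z] [Fintype D]

omit [Fintype x] [DecidableEq x] [Fintype z] [DecidableEq z] in
theorem kronecker_induction [Finite x] [Finite z]
    {p : Matrix (x × z) (x × z) ℂ → Prop} (hkronecker : ∀ A B, p (A ⊗ₖ B))
    (hadd : ∀ Z Z', p Z → p Z' → p (Z + Z')) (Z : Matrix (x × z) (x × z) ℂ) : p Z := by
  classical
  refine Matrix.induction_on' Z ?_ hadd fun i j c => ?_
  · simpa only [zero_kronecker] using hkronecker 0 0
  · simpa only [single_kronecker_single, mul_one] using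
      hkronecker (single i.1 j.1 c) (single i.2 j.2 1)

theorem conj_kronecker (G : Matrix x x ℂ) (H : Matrix z z ℂ) (A : Matrix x x ℂ)
    (B : Matrix z z ℂ) : conj (G ⊗ₖ H) (A ⊗ₖ B) = conj G A ⊗ₖ conj H B := by
  simp only [conj_apply, conjTranspose_kronecker, ← mul_kronecker_mul]

omit [DecidableEq x] [DecidableEq z] in
theorem commute_kronecker {G A : Matrix x x ℂ} {H B : Matrix z z ℂ} (hGA : Commute G A)
    (hHB : Commute H B) : Commute (G ⊗ₖ H) (A ⊗ₖ B) := by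
  rw [commute_iff_eq, ← mul_kronecker_mul, ← mul_kronecker_mul, hGA.eq, hHB.eq]

omit [DecidableEq x] [DecidableEq z] [Fintype x] [Fintype z] in
theorem sum_kronecker (f : D → Matrix x x ℂ) (B : Matrix z z ℂ) :
    (∑ d, f d) ⊗ₖ B = ∑ d, f d ⊗ₖ B :=
  map_sum ((kroneckerBilinear (R := ℂ)).flip B) f Finset.univ

omit [DecidableEq x] [DecidableEq z] [Fintype x] [Fintype z] in
theorem kronecker_sum (A : Matrix x x ℂ) (f : D → Matrix z z ℂ) :
    A ⊗ₖ (∑ d, f d) = ∑ d, A ⊗ₖ f d :=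
  map_sum (kroneckerBilinear (R := ℂ) A) f Finset.univ

/-- The operators `G d` acting on the first factor of a tensor product. -/
def onLeft (z : Type*) [DecidableEq z] (G : D → Matrix x x ℂ) (d : D) :
    Matrix (x × z) (x × z) ℂ :=
  G d ⊗ₖ 1

/-- The operators `G d` acting on the second factor of a tensor product. -/
def onRight (x : Type*) [DecidableEq x] (G : D → Matrix z z ℂ) (d : D) :
    Matrix (x × z) (x × z) ℂ :=
  1 ⊗ₖ G d

theorem twirl_onLeft (G : D → Matrix x x ℂ) (A : Matrix x x ℂ) (B : Matrix z z ℂ) :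
    twirl (onLeft z G) (A ⊗ₖ B) = twirl G A ⊗ₖ B := by
  simp only [twirl_apply, onLeft, conj_kronecker, map_one, Module.End.one_apply, smul_kronecker,
    sum_kronecker]

theorem twirl_onRight (G : D → Matrix z z ℂ) (A : Matrix x x ℂ) (B : Matrix z z ℂ) :
    twirl (onRight x G) (A ⊗ₖ B) = A ⊗ₖ twirl G B := by
  simp only [twirl_apply, onRight, conj_kronecker, map_one, Module.End.one_apply, kronecker_smul,
    kronecker_sum]

section PartialTrace

omit [DecidableEq x] [Fintype z] [DecidableEq z] [Fintype D]

/-- The partial trace over the first tensor factor. -/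
def partialTraceLeft : Matrix (x × z) (x × z) ℂ →ₗ[ℂ] Matrix z z ℂ where
  toFun Z := of fun i j => ∑ a, Z (a, i) (a, j)
  map_add' Z Z' := by
    ext i j
    exact Finset.sum_add_distrib
  map_smul' c Z := by
    ext i j
    exact (Finset.mul_sum _ _ _).symm

theorem partialTraceLeft_kronecker (A : Matrix x x ℂ) (B : Matrix z z ℂ) :
    partialTraceLeft (A ⊗ₖ B) = A.trace • B := by
  ext i j
  exact (Finset.sum_mul Finset.univ (fun a => A a a) (B i j)).symm

theorem trace_partialTraceLeft [Fintype z] (Z : Matrix (x × z) (x × z) ℂ) :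
    (partialTraceLeft Z).trace = Z.trace := by
  simp only [trace, diag_apply, Fintype.sum_prod_type]
  exact Finset.sum_comm

theorem partialTraceLeft_eq_sum_submatrix (Z : Matrix (x × z) (x × z) ℂ) :
    partialTraceLeft Z = ∑ a, Z.submatrix (Prod.mk a) (Prod.mk a) := by
  ext i j
  exact (Matrix.sum_apply i j Finset.univ fun a => Z.submatrix (Prod.mk a) (Prod.mk a)).symm

theorem isHermitian_partialTraceLeft {Z : Matrix (x × z) (x × z) ℂ} (hZ : Z.IsHermitian) :
    (partialTraceLeft Z).IsHermitian := by
  rw [partialTraceLeft_eq_sum_submatrix]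
  exact isSelfAdjoint_sum _ fun a _ => hZ.submatrix _

theorem posSemidef_partialTraceLeft {Z : Matrix (x × z) (x × z) ℂ} (hZ : Z.PosSemidef) :
    (partialTraceLeft Z).PosSemidef := by
  rw [partialTraceLeft_eq_sum_submatrix]
  exact posSemidef_sum _ fun a _ => hZ.submatrix _

end PartialTrace

theorem partialTraceLeft_twirl_onRight (G : D → Matrix z z ℂ)
    (Z : Matrix (x × z) (x × z) ℂ) :
    partialTraceLeft (twirl (onRight x G) Z) = twirl G (partialTraceLeft Z) := by
  induction Z using kronecker_induction with
  | hkronecker A B => simp only [twirl_onRight, partialTraceLeft_kronecker, map_smul]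
  | hadd Z Z' hZ hZ' => simp only [map_add, hZ, hZ']

section Mixed

omit [Fintype z] [DecidableEq z] [Fintype D]

theorem trace_mixed [Nonempty x] : (mixed x).trace = 1 := by
  rw [mixed, trace_smul, trace_one, smul_eq_mul,
    inv_mul_cancel₀ (Nat.cast_ne_zero.2 Fintype.card_ne_zero)]

theorem posSemidef_mixed : (mixed x).PosSemidef :=
  PosSemidef.one.smul (by positivity)

theorem commute_mixed (G : Matrix x x ℂ) : Commute G (mixed x) :=
  (Commute.one_right G).smul_right _

theorem trace_mixed_kronecker [Fintype z] [Nonempty x] (B : Matrix z z ℂ) :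
    (mixed x ⊗ₖ B).trace = B.trace := by
  rw [trace_kronecker, trace_mixed, one_mul]

end Mixed

omit [Fintype D] in
theorem commute_onLeft_mixed_kronecker (G : D → Matrix x x ℂ) (B : Matrix z z ℂ) (d : D) :
    Commute (onLeft z G d) (mixed x ⊗ₖ B) :=
  commute_kronecker (commute_mixed _) (Commute.one_left _)

theorem traceNorm_mixed_kronecker_le [Nonempty x] {B : Matrix z z ℂ} (hB : B.IsHermitian) :
    traceNorm (mixed x ⊗ₖ B) ≤ traceNorm B :=
  traceNorm_map_le_of_positive (kroneckerBilinear (R := ℂ) (mixed x))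
    (fun _ hP => posSemidef_mixed.kronecker hP)
    (fun P _ => by
      refine (congrArg Complex.re (trace_kronecker (mixed x) P)).le.trans_eq ?_
      rw [trace_mixed, one_mul]) hB

theorem IsTwirlingDesign.isTwirlingDesign_onRight {G : D → Matrix z z ℂ} (hG : IsTwirlingDesign G) :
    IsTwirlingDesign (onRight x G) where
  mem_unitaryGroup d := kronecker_mem_unitary (one_mem _) (hG.mem_unitaryGroup d)
  conj_mul_twirl d := by
    ext Z : 1
    induction Z using kronecker_induction with
    | hkronecker A B =>
      rw [Module.End.mul_apply, twirl_onRight, onRight, conj_kronecker, map_one,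
        Module.End.one_apply, ← Module.End.mul_apply, hG.conj_mul_twirl]
    | hadd Z Z' hZ hZ' => rw [map_add, map_add, hZ, hZ']

end TensorFactors

section OneDesigns

variable {x z : Type*} [Fintype x] [DecidableEq x] [Fintype z] [DecidableEq z] {N : ℕ}
  {U : Fin N → Matrix x x ℂ}

theorem IsOneDesign.twirl_apply (hU : IsOneDesign U) (ω : Matrix x x ℂ) :
    twirl U ω = ω.trace • mixed x := by
  rw [ConvexSplit.twirl_apply, Fintype.card_fin, ← hU.2 ω]
  simp only [conj_apply]

theorem IsOneDesign.twirl_onLeft_apply (hU : IsOneDesign U)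
    (Z : Matrix (x × z) (x × z) ℂ) :
    twirl (onLeft z U) Z = mixed x ⊗ₖ partialTraceLeft Z := by
  induction Z using kronecker_induction with
  | hkronecker A B =>
    rw [twirl_onLeft, hU.twirl_apply, partialTraceLeft_kronecker, smul_kronecker,
      kronecker_smul]
  | hadd Z Z' hZ hZ' => rw [map_add, map_add, hZ, hZ', kronecker_add]

theorem IsOneDesign.isTwirlingDesign_onLeft (hU : IsOneDesign U) :
    IsTwirlingDesign (onLeft z U) where
  mem_unitaryGroup d := kronecker_mem_unitary (hU.1 d) (one_mem _)
  conj_mul_twirl d := by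
    have hconj : conj (U d) (mixed x) = mixed x := by
      rw [conj_apply, (commute_mixed (U d)).eq, Matrix.mul_assoc, ← star_eq_conjTranspose,
        mem_unitaryGroup_iff.1 (hU.1 d), mul_one]
    ext Z : 1
    rw [Module.End.mul_apply, hU.twirl_onLeft_apply, onLeft, conj_kronecker, hconj, map_one,
      Module.End.one_apply]

theorem IsOneDesign.traceNorm_twirl_onLeft_le [Nonempty x] (hU : IsOneDesign U)
    {Z : Matrix (x × z) (x × z) ℂ} (hZ : Z.IsHermitian) :
    traceNorm (twirl (onLeft z U) Z) ≤ traceNorm (partialTraceLeft Z) := by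
  rw [hU.twirl_onLeft_apply]
  exact traceNorm_mixed_kronecker_le (isHermitian_partialTraceLeft hZ)

end OneDesigns

section Bipartite

variable {x y m D K K' : Type*} [Fintype x] [DecidableEq x] [Fintype y] [DecidableEq y]
  [Fintype m] [DecidableEq m] [Fintype D] [Fintype K] [Fintype K'] {N N' : ℕ}
  {U : Fin N → Matrix x x ℂ} {W : Fin N' → Matrix y y ℂ} {ρ Z : Matrix (x × y × m) (x × y × m) ℂ}

section Marginals

omit [DecidableEq x] [DecidableEq y] [Fintype m] [DecidableEq m]

omit [Fintype x] in
theorem marginalXM_sub (Z Z' : Matrix (x × y × m) (x × y × m) ℂ) :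
    marginalXM (Z - Z') = marginalXM Z - marginalXM Z' := by
  ext i j
  exact Finset.sum_sub_distrib _ _

omit [Fintype y] in
theorem marginalYM_eq_partialTraceLeft (Z : Matrix (x × y × m) (x × y × m) ℂ) :
    marginalYM Z = partialTraceLeft Z :=
  rfl

theorem marginalM_eq_partialTraceLeft_marginalXM (Z : Matrix (x × y × m) (x × y × m) ℂ) :
    marginalM Z = partialTraceLeft (marginalXM Z) :=
  rfl

theorem marginalM_eq_partialTraceLeft_marginalYM (Z : Matrix (x × y × m) (x × y × m) ℂ) :
    marginalM Z = partialTraceLeft (marginalYM Z) := by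
  ext i j
  exact Finset.sum_comm

/-- The exchange of the first two tensor factors, which turns the partial trace over the second
factor into the partial trace over the first. -/
def exchange (y x m : Type*) : y × x × m ≃ x × y × m where
  toFun p := (p.2.1, p.1, p.2.2)
  invFun p := (p.2.1, p.1, p.2.2)
  left_inv _ := rfl
  right_inv _ := rfl

omit [Fintype x] in
theorem marginalXM_eq_partialTraceLeft (Z : Matrix (x × y × m) (x × y × m) ℂ) :
    marginalXM Z = partialTraceLeft (Z.submatrix (exchange y x m) (exchange y x m)) :=
  rfl

omit [Fintype x] [Fintype y] in
theorem kronecker_submatrix_exchange (A : Matrix x x ℂ) (B : Matrix y y ℂ) (C : Matrix m m ℂ) :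
    (A ⊗ₖ (B ⊗ₖ C)).submatrix (exchange y x m) (exchange y x m) = B ⊗ₖ (A ⊗ₖ C) := by
  ext i j
  exact mul_left_comm _ _ _

theorem trace_marginalXM [Fintype m] (Z : Matrix (x × y × m) (x × y × m) ℂ) :
    (marginalXM Z).trace = Z.trace := by
  rw [marginalXM_eq_partialTraceLeft, trace_partialTraceLeft]
  exact (exchange y x m).sum_comp fun i => Z i i

theorem trace_marginalYM [Fintype m] (Z : Matrix (x × y × m) (x × y × m) ℂ) :
    (marginalYM Z).trace = Z.trace :=
  trace_partialTraceLeft Z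

theorem trace_marginalM [Fintype m] (Z : Matrix (x × y × m) (x × y × m) ℂ) :
    (marginalM Z).trace = Z.trace := by
  rw [marginalM_eq_partialTraceLeft_marginalXM, trace_partialTraceLeft, trace_marginalXM]

theorem posSemidef_marginalM [Finite m] (hρ : ρ.PosSemidef) : (marginalM ρ).PosSemidef :=
  posSemidef_partialTraceLeft (posSemidef_partialTraceLeft (hρ.submatrix (exchange y x m)))

end Marginals

theorem twirl_submatrix_equiv {n k : Type*} [Fintype n] [DecidableEq n] [Fintype k]
    [DecidableEq k] (G : D → Matrix n n ℂ) (e : k ≃ n) (Z : Matrix n n ℂ) :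
    (twirl G Z).submatrix e e = twirl (fun d => (G d).submatrix e e) (Z.submatrix e e) := by
  simp only [twirl_apply, conj_apply, conjTranspose_submatrix, submatrix_mul_equiv]
  ext i j
  simp only [submatrix_apply, Matrix.smul_apply, Matrix.sum_apply]

theorem twirl_onRight_onLeft_submatrix_exchange (G : D → Matrix y y ℂ)
    (Z : Matrix (x × y × m) (x × y × m) ℂ) :
    (twirl (onRight x (onLeft m G)) Z).submatrix (exchange y x m) (exchange y x m)
      = twirl (onLeft (x × m) G) (Z.submatrix (exchange y x m) (exchange y x m)) := by
  simp only [twirl_submatrix_equiv, onRight, onLeft, kronecker_submatrix_exchange,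
    one_kronecker_one]
  rfl

theorem twirl_onLeft_submatrix_exchange (G : D → Matrix x x ℂ)
    (Z : Matrix (x × y × m) (x × y × m) ℂ) :
    (twirl (onLeft (y × m) G) Z).submatrix (exchange y x m) (exchange y x m)
      = twirl (onRight y (onLeft m G)) (Z.submatrix (exchange y x m) (exchange y x m)) := by
  simp only [twirl_submatrix_equiv, onLeft, ← one_kronecker_one (m := y) (n := m),
    kronecker_submatrix_exchange]
  rfl

theorem marginalXM_twirl_onLeft (G : D → Matrix x x ℂ) (Z : Matrix (x × y × m) (x × y × m) ℂ) :
    marginalXM (twirl (onLeft (y × m) G) Z) = twirl (onLeft m G) (marginalXM Z) := by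
  rw [marginalXM_eq_partialTraceLeft, twirl_onLeft_submatrix_exchange,
    partialTraceLeft_twirl_onRight, ← marginalXM_eq_partialTraceLeft]

theorem marginalXM_twirl_one_sub_twirl {D' : Type*} [Fintype D'] (G : D → Matrix x x ℂ)
    (H : D' → Matrix x x ℂ) (Z : Matrix (x × y × m) (x × y × m) ℂ) :
    marginalXM (twirl (onLeft (y × m) G) ((1 - twirl (onLeft (y × m) H)) Z))
      = twirl (onLeft m G) ((1 - twirl (onLeft m H)) (marginalXM Z)) := by
  simp only [LinearMap.sub_apply, Module.End.one_apply, marginalXM_twirl_onLeft, marginalXM_sub]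

theorem marginalYM_twirl_one_sub_twirl {D' : Type*} [Fintype D']
    (G : D → Matrix (y × m) (y × m) ℂ) (H : D' → Matrix (y × m) (y × m) ℂ)
    (Z : Matrix (x × y × m) (x × y × m) ℂ) :
    marginalYM (twirl (onRight x G) ((1 - twirl (onRight x H)) Z))
      = twirl G ((1 - twirl H) (marginalYM Z)) := by
  simp only [LinearMap.sub_apply, Module.End.one_apply, marginalYM_eq_partialTraceLeft,
    partialTraceLeft_twirl_onRight, map_sub]

theorem IsOneDesign.traceNorm_twirl_onRight_onLeft_le [Nonempty y] (hW : IsOneDesign W)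
    (hZ : Z.IsHermitian) :
    traceNorm (twirl (onRight x (onLeft m W)) Z) ≤ traceNorm (marginalXM Z) := by
  have hsymm := traceNorm_submatrix_equiv_le
    ((isHermitian_twirl (onRight x (onLeft m W)) hZ).submatrix (exchange y x m))
    (exchange y x m).symm
  rw [submatrix_submatrix, Equiv.self_comp_symm, submatrix_id_id,
    twirl_onRight_onLeft_submatrix_exchange] at hsymm
  exact hsymm.trans (hW.traceNorm_twirl_onLeft_le (hZ.submatrix _))

theorem IsOneDesign.twirl_mul_twirl_apply (hU : IsOneDesign U) (hW : IsOneDesign W)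
    (Z : Matrix (x × y × m) (x × y × m) ℂ) :
    (twirl (onLeft (y × m) U) * twirl (onRight x (onLeft m W))) Z
      = mixed x ⊗ₖ (mixed y ⊗ₖ marginalM Z) := by
  rw [Module.End.mul_apply, hU.twirl_onLeft_apply, partialTraceLeft_twirl_onRight,
    hW.twirl_onLeft_apply, ← marginalYM_eq_partialTraceLeft,
    ← marginalM_eq_partialTraceLeft_marginalYM]

omit [Fintype D] in
theorem commute_onLeft_onRight {D' z : Type*} [Fintype z] [DecidableEq z] (G : D → Matrix x x ℂ)
    (H : D' → Matrix z z ℂ) (d : D) (d' : D') : Commute (onLeft z G d) (onRight x H d') :=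
  commute_kronecker (Commute.one_right _) (Commute.one_left _)

theorem traceNorm_twirl_mul_twirl_sub_le [Nonempty x] [Nonempty y] [Nonempty K] [Nonempty K']
    (hU : IsOneDesign U) (hW : IsOneDesign W) (hZ : Z.IsHermitian) (f : K → Fin N)
    (f' : K' → Fin N') :
    traceNorm ((twirl (fun k => onLeft (y × m) U (f k))
          * twirl (fun k => onRight x (onLeft m W) (f' k))
        - twirl (onLeft (y × m) U) * twirl (onRight x (onLeft m W))) Z)
      ≤ traceNorm ((twirl (fun k => onLeft (y × m) U (f k))
            * twirl (fun k => onRight x (onLeft m W) (f' k)))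
          (((1 - twirl (onLeft (y × m) U)) * (1 - twirl (onRight x (onLeft m W)))) Z))
        + traceNorm (twirl (fun k => onLeft m U (f k)) ((1 - twirl (onLeft m U)) (marginalXM Z)))
        + traceNorm (twirl (fun k => onLeft m W (f' k))
            ((1 - twirl (onLeft m W)) (marginalYM Z))) := by
  have hE : IsTwirlingDesign (onLeft (y × m) U) := hU.isTwirlingDesign_onLeft
  have hF : IsTwirlingDesign (onRight x (onLeft m W)) :=
    hW.isTwirlingDesign_onLeft.isTwirlingDesign_onRight
  have hX : ((1 - twirl (onLeft (y × m) U)) Z).IsHermitian := hZ.sub (isHermitian_twirl _ hZ)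
  have hY : ((1 - twirl (onRight x (onLeft m W))) Z).IsHermitian :=
    hZ.sub (isHermitian_twirl _ hZ)
  have hAX := isHermitian_twirl (fun k => onLeft (y × m) U (f k)) hX
  have hAY := isHermitian_twirl (fun k => onRight x (onLeft m W) (f' k)) hY
  have hAXY := isHermitian_twirl (fun k => onLeft (y × m) U (f k))
    (isHermitian_twirl (fun k => onRight x (onLeft m W) (f' k))
      (hY.sub (isHermitian_twirl (onLeft (y × m) U) hY)))
  have hTX := isHermitian_twirl (onRight x (onLeft m W)) hAX
  have hTY := isHermitian_twirl (onLeft (y × m) U) hAY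
  rw [hE.twirl_mul_twirl_sub_eq hF (commute_onLeft_onRight U (onLeft m W)) f f']
  refine (traceNorm_add_le (hAXY.add hTX) hTY).trans (add_le_add
    ((traceNorm_add_le hAXY hTX).trans (add_le_add le_rfl ?_)) ?_)
  · exact (hW.traceNorm_twirl_onRight_onLeft_le hAX).trans_eq
      (congrArg traceNorm (marginalXM_twirl_one_sub_twirl (fun k => U (f k)) U Z))
  · exact (hU.traceNorm_twirl_onLeft_le hAY).trans_eq
      (congrArg traceNorm
        (marginalYM_twirl_one_sub_twirl (fun k => onLeft m W (f' k)) (onLeft m W) Z))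

section Decoupling

variable {S T : Type*} [Fintype S] [Nonempty S] [Fintype T] [Nonempty T] {h : K → S → Fin N}
  {h' : K' → T → Fin N'} {ε c : ℝ}

theorem IsOneDesign.sum_traceNorm_twirl_onLeft_lt [Nonempty x] [Nonempty K] {z : Type*}
    [Fintype z] [DecidableEq z] {α : Matrix (x × z) (x × z) ℂ} {γ : Matrix z z ℂ}
    (hU : IsOneDesign U) (hh : IsPairwiseIndependent h) (hα : α.IsHermitian) (hγ : γ.PosSemidef)
    (hγ0 : 0 < γ.trace.re) (hc : 0 < c)
    (hlt : smoothRenyiTwo ε α (mixed x ⊗ₖ γ) + log2 c⁻¹ < log2 (Fintype.card K)) :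
    ∑ s, traceNorm (twirl (fun k => onLeft z U (h k s)) ((1 - twirl (onLeft z U)) α))
      < Fintype.card S * (2 * (ε * α.trace.re + √γ.trace.re * √c)) := by
  rw [← trace_mixed_kronecker (x := x) γ] at hγ0 ⊢
  exact sum_traceNorm_twirl_one_sub_twirl_lt hU.isTwirlingDesign_onLeft hh hα
    (posSemidef_mixed.kronecker hγ) (ne_zero_of_re_trace_pos hγ0)
    (commute_onLeft_mixed_kronecker U γ) hc hlt

theorem sum_traceNorm_twirl_onLeft_onRight_lt [Nonempty x] [Nonempty y] [Nonempty K]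
    [Nonempty K'] {γ : Matrix m m ℂ} (hU : IsOneDesign U) (hW : IsOneDesign W)
    (hh : IsPairwiseIndependent h) (hh' : IsPairwiseIndependent h') (hρ : ρ.IsHermitian)
    (hγ : γ.PosSemidef) (hγ0 : 0 < γ.trace.re) (hc : 0 < c)
    (hlt : smoothRenyiTwo ε ρ (mixed x ⊗ₖ (mixed y ⊗ₖ γ)) + log2 c⁻¹
      < log2 (Fintype.card (K × K'))) :
    ∑ r : S × T, traceNorm ((twirl (fun k => onLeft (y × m) U (h k r.1))
          * twirl (fun k => onRight x (onLeft m W) (h' k r.2)))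
        (((1 - twirl (onLeft (y × m) U)) * (1 - twirl (onRight x (onLeft m W)))) ρ))
      < Fintype.card (S × T) * (4 * (ε * ρ.trace.re + √γ.trace.re * √c)) := by
  rw [← trace_mixed_kronecker (x := y) γ, ← trace_mixed_kronecker (x := x) (mixed y ⊗ₖ γ)]
    at hγ0 ⊢
  exact sum_traceNorm_twirl_twirl_lt hU.isTwirlingDesign_onLeft
    hW.isTwirlingDesign_onLeft.isTwirlingDesign_onRight
    (commute_onLeft_onRight U (onLeft m W)) hh hh' hρ
    (posSemidef_mixed.kronecker (posSemidef_mixed.kronecker hγ)) (ne_zero_of_re_trace_pos hγ0)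
    (commute_onLeft_mixed_kronecker U _)
    (fun d => commute_kronecker (Commute.one_left _) (commute_onLeft_mixed_kronecker W γ d))
    hc hlt

theorem sum_traceNorm_twirl_mul_twirl_sub_lt [Nonempty K] [Nonempty K'] (hU : IsOneDesign U)
    (hW : IsOneDesign W) (hh : IsPairwiseIndependent h) (hh' : IsPairwiseIndependent h')
    (hρ : ρ.PosSemidef) (hρ0 : ρ ≠ 0) (hc : 0 < c)
    (hXM : smoothRenyiTwo ε (marginalXM ρ) (mixed x ⊗ₖ marginalM ρ) + log2 c⁻¹
      < log2 (Fintype.card K))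
    (hYM : smoothRenyiTwo ε (marginalYM ρ) (mixed y ⊗ₖ marginalM ρ) + log2 c⁻¹
      < log2 (Fintype.card K'))
    (hXYM : smoothRenyiTwo ε ρ (mixed x ⊗ₖ (mixed y ⊗ₖ marginalM ρ)) + log2 c⁻¹
      < log2 (Fintype.card (K × K'))) :
    ∑ r : S × T, traceNorm ((twirl (fun k => onLeft (y × m) U (h k r.1))
          * twirl (fun k => onRight x (onLeft m W) (h' k r.2))
        - twirl (onLeft (y × m) U) * twirl (onRight x (onLeft m W))) ρ)
      < Fintype.card (S × T) * (8 * (ε * ρ.trace.re + √ρ.trace.re * √c)) := by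
  obtain ⟨⟨i, j, _⟩⟩ := nonempty_of_ne_zero hρ0
  have : Nonempty x := ⟨i⟩
  have : Nonempty y := ⟨j⟩
  have hM := posSemidef_marginalM hρ
  have hM0 : 0 < (marginalM ρ).trace.re := by
    rw [trace_marginalM]
    exact re_trace_pos hρ hρ0
  have hboth := sum_traceNorm_twirl_onLeft_onRight_lt (S := S) (T := T) hU hW hh hh'
    hρ.isHermitian hM hM0 hc hXYM
  have hleft := hU.sum_traceNorm_twirl_onLeft_lt (S := S) (α := marginalXM ρ) hh
    (isHermitian_partialTraceLeft (hρ.isHermitian.submatrix (exchange y x m))) hM hM0 hc hXM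
  have hright := hW.sum_traceNorm_twirl_onLeft_lt (S := T) (α := marginalYM ρ) hh'
    (isHermitian_partialTraceLeft hρ.isHermitian) hM hM0 hc hYM
  rw [trace_marginalM] at hboth hleft hright
  rw [trace_marginalXM] at hleft
  rw [trace_marginalYM] at hright
  have hS : (0 : ℝ) < Fintype.card S := Nat.cast_pos.2 Fintype.card_pos
  have hT : (0 : ℝ) < Fintype.card T := Nat.cast_pos.2 Fintype.card_pos
  refine (Finset.sum_le_sum fun r _ => traceNorm_twirl_mul_twirl_sub_le hU hW hρ.isHermitian
    (fun k => h k r.1) fun k => h' k r.2).trans_lt ?_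
  simp only [Fintype.sum_prod_type, Finset.sum_add_distrib, Finset.sum_const, Finset.card_univ,
    nsmul_eq_mul, ← Finset.mul_sum, Fintype.card_prod, Nat.cast_mul] at hboth ⊢
  linarith [mul_lt_mul_of_pos_left hleft hT, mul_lt_mul_of_pos_left hright hS]

end Decoupling

end Bipartite

section SeedRegisters

variable {x y m S T : Type*} [Fintype x] [DecidableEq x] [Fintype y] [DecidableEq y]
  [Fintype m] [DecidableEq m] [Fintype S] [DecidableEq S] [Fintype T] [DecidableEq T]

/-- The rearrangement `rearrange` for arbitrary seed registers. -/
def rearrangeSeeds (x y m S T : Type*) : (x × y × m) × (S × T) ≃ (x × S) × (y × T) × m where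
  toFun p := ((p.1.1, p.2.1), (p.1.2.1, p.2.2), p.1.2.2)
  invFun q := ((q.1.1, q.2.1.1, q.2.2), (q.1.2, q.2.1.2))
  left_inv _ := rfl
  right_inv _ := rfl

variable (S T) in
/-- The operator `withCatalyst` for arbitrary seed registers. -/
def withSeeds (ω : Matrix (x × y × m) (x × y × m) ℂ) :
    Matrix ((x × S) × (y × T) × m) ((x × S) × (y × T) × m) ℂ :=
  reindex (rearrangeSeeds x y m S T) (rearrangeSeeds x y m S T) (ω ⊗ₖ mixed (S × T))

/-- The state `convexSplitState` for arbitrary seed registers. -/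
def seededConvexSplitState {A B : ℕ} (V : Fin A → Matrix (x × S) (x × S) ℂ)
    (W : Fin B → Matrix (y × T) (y × T) ℂ) (ρ : Matrix (x × y × m) (x × y × m) ℂ) :
    Matrix ((x × S) × (y × T) × m) ((x × S) × (y × T) × m) ℂ :=
  ((A : ℂ) * (B : ℂ))⁻¹ • ∑ a, ∑ b,
    (V a ⊗ₖ (W b ⊗ₖ (1 : Matrix m m ℂ))) * withSeeds S T ρ *
      (V a ⊗ₖ (W b ⊗ₖ (1 : Matrix m m ℂ))).conjTranspose

variable (S T) in
/-- The state `decoupledState` for arbitrary seed registers. -/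
def seededDecoupledState (ρ : Matrix (x × y × m) (x × y × m) ℂ) :
    Matrix ((x × S) × (y × T) × m) ((x × S) × (y × T) × m) ℂ :=
  withSeeds S T (mixed x ⊗ₖ (mixed y ⊗ₖ marginalM ρ))

/-- The classical-quantum operator `|S × T|⁻¹ ∑ᵣ f r ⊗ |r⟩⟨r|` with uniformly random seeds, on the
factors in the order `X S Y T M`. -/
def seedAverage : (S × T → Matrix (x × y × m) (x × y × m) ℂ) →ₗ[ℂ]
    Matrix ((x × S) × (y × T) × m) ((x × S) × (y × T) × m) ℂ where
  toFun f := (Fintype.card (S × T) : ℂ)⁻¹ •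
    reindex (rearrangeSeeds x y m S T) (rearrangeSeeds x y m S T) (blockDiagonal f)
  map_add' f g := by
    rw [blockDiagonal_add, ← smul_add]
    rfl
  map_smul' c f := by
    rw [blockDiagonal_smul, smul_comm]
    rfl

omit [Fintype x] [DecidableEq x] [Fintype y] [DecidableEq y] [Fintype m] [DecidableEq m] in
theorem seedAverage_apply (f : S × T → Matrix (x × y × m) (x × y × m) ℂ) :
    seedAverage f = (Fintype.card (S × T) : ℂ)⁻¹ •
      reindex (rearrangeSeeds x y m S T) (rearrangeSeeds x y m S T) (blockDiagonal f) :=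
  rfl

omit [Fintype x] [DecidableEq x] [Fintype y] [DecidableEq y] [Fintype m] [DecidableEq m] in
theorem withSeeds_eq_seedAverage (ω : Matrix (x × y × m) (x × y × m) ℂ) :
    withSeeds S T ω = seedAverage fun _ : S × T => ω := by
  rw [withSeeds, mixed, kronecker_smul, kronecker_one, seedAverage_apply]
  rfl

omit [Fintype x] [DecidableEq x] [Fintype y] [DecidableEq y] [Fintype m] in
theorem kronecker_sum_single_eq_reindex (G : S → Matrix x x ℂ) (H : T → Matrix y y ℂ) :
    (∑ s, G s ⊗ₖ single s s (1 : ℂ)) ⊗ₖ ((∑ t, H t ⊗ₖ single t t (1 : ℂ)) ⊗ₖ (1 : Matrix m m ℂ))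
      = reindex (rearrangeSeeds x y m S T) (rearrangeSeeds x y m S T)
          (blockDiagonal fun r => G r.1 ⊗ₖ (H r.2 ⊗ₖ (1 : Matrix m m ℂ))) := by
  ext ⟨⟨i, s⟩, ⟨j, t⟩, k⟩ ⟨⟨i', s'⟩, ⟨j', t'⟩, k'⟩
  simp only [kroneckerMap_apply, Matrix.sum_apply, single_apply, reindex_apply, submatrix_apply,
    rearrangeSeeds, Equiv.coe_fn_symm_mk, blockDiagonal_apply]
  by_cases hs : s = s' <;> by_cases ht : t = t' <;> simp [hs, ht, ite_and]

theorem mul_seedAverage_mul_conjTranspose (G f : S × T → Matrix (x × y × m) (x × y × m) ℂ) :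
    reindex (rearrangeSeeds x y m S T) (rearrangeSeeds x y m S T) (blockDiagonal G)
        * seedAverage f
        * (reindex (rearrangeSeeds x y m S T) (rearrangeSeeds x y m S T) (blockDiagonal G))ᴴ
      = seedAverage fun r => conj (G r) (f r) := by
  simp only [seedAverage_apply, reindex_apply, conjTranspose_submatrix,
    blockDiagonal_conjTranspose, Matrix.mul_smul, Matrix.smul_mul, submatrix_mul_equiv,
    ← blockDiagonal_mul, conj_apply]

theorem traceNorm_seedAverage_le {f : S × T → Matrix (x × y × m) (x × y × m) ℂ}
    (hf : ∀ r, (f r).IsHermitian) :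
    traceNorm (seedAverage f) ≤ (Fintype.card (S × T) : ℝ)⁻¹ * ∑ r, traceNorm (f r) := by
  have hdiag : (blockDiagonal f).IsHermitian := by
    rw [IsHermitian, blockDiagonal_conjTranspose]
    exact congrArg blockDiagonal (funext fun r => hf r)
  rw [seedAverage_apply, traceNorm_smul, norm_inv, Complex.norm_natCast]
  gcongr
  exact (traceNorm_submatrix_equiv_le hdiag _).trans (traceNorm_blockDiagonal_le hf)

variable {A B N N' : ℕ} {U : Fin N → Matrix x x ℂ} {U' : Fin N' → Matrix y y ℂ}
  {h : Fin A → S → Fin N} {h' : Fin B → T → Fin N'} {ρ : Matrix (x × y × m) (x × y × m) ℂ}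

theorem onLeft_mul_onRight_onLeft (U : Fin N → Matrix x x ℂ) (U' : Fin N' → Matrix y y ℂ)
    (d : Fin N) (d' : Fin N') : onLeft (y × m) U d * onRight x (onLeft m U') d'
      = U d ⊗ₖ (U' d' ⊗ₖ (1 : Matrix m m ℂ)) := by
  rw [onLeft, onRight, onLeft, ← mul_kronecker_mul, mul_one, one_mul]

theorem seededConvexSplitState_eq_seedAverage {V : Fin A → Matrix (x × S) (x × S) ℂ}
    {W : Fin B → Matrix (y × T) (y × T) ℂ}
    (hV : ∀ a, V a = ∑ s, U (h a s) ⊗ₖ single s s (1 : ℂ))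
    (hW : ∀ b, W b = ∑ t, U' (h' b t) ⊗ₖ single t t (1 : ℂ)) :
    seededConvexSplitState V W ρ = seedAverage fun r : S × T =>
      (twirl (fun a => onLeft (y × m) U (h a r.1))
        * twirl fun b => onRight x (onLeft m U') (h' b r.2)) ρ := by
  simp only [seededConvexSplitState, hV, hW, withSeeds_eq_seedAverage,
    kronecker_sum_single_eq_reindex (fun s => U (h _ s)) (fun t => U' (h' _ t)),
    mul_seedAverage_mul_conjTranspose, ← map_sum, ← map_smul]
  congr 1 with r : 1
  simp only [twirl_mul_twirl, twirl_apply, onLeft_mul_onRight_onLeft, Fintype.card_prod,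
    Fintype.card_fin, Nat.cast_mul, Fintype.sum_prod_type, Pi.smul_apply, Finset.sum_apply]

theorem seededDecoupledState_eq_seedAverage (hU : IsOneDesign U) (hU' : IsOneDesign U') :
    seededDecoupledState S T ρ = seedAverage fun _ : S × T =>
      (twirl (onLeft (y × m) U) * twirl (onRight x (onLeft m U'))) ρ := by
  rw [seededDecoupledState, withSeeds_eq_seedAverage, hU.twirl_mul_twirl_apply hU']

theorem traceNorm_seededConvexSplitState_sub_lt [Nonempty S] [Nonempty T] {ε c : ℝ}
    {V : Fin A → Matrix (x × S) (x × S) ℂ} {W : Fin B → Matrix (y × T) (y × T) ℂ}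
    (hρ : ρ.PosSemidef) (hρ0 : ρ ≠ 0) (hc : 0 < c) (hV : IsHashDesignFamily V)
    (hW : IsHashDesignFamily W)
    (hXM : smoothRenyiTwo ε (marginalXM ρ) (mixed x ⊗ₖ marginalM ρ) + log2 c⁻¹ < log2 A)
    (hYM : smoothRenyiTwo ε (marginalYM ρ) (mixed y ⊗ₖ marginalM ρ) + log2 c⁻¹ < log2 B)
    (hXYM : smoothRenyiTwo ε ρ (mixed x ⊗ₖ (mixed y ⊗ₖ marginalM ρ)) + log2 c⁻¹
      < log2 A + log2 B) :
    traceNorm (seededConvexSplitState V W ρ - seededDecoupledState S T ρ)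
      < 8 * (ε * ρ.trace.re + √ρ.trace.re * √c) := by
  obtain ⟨N, U, h, hU, hh, hVU⟩ := hV
  obtain ⟨N', U', h', hU', hh', hWU'⟩ := hW
  have hA := pos_of_lt_log2 hXM
  have hB := pos_of_lt_log2 hYM
  have : Nonempty (Fin A) := ⟨⟨0, hA⟩⟩
  have : Nonempty (Fin B) := ⟨⟨0, hB⟩⟩
  have hlog : log2 A + log2 B = log2 (Fintype.card (Fin A × Fin B)) := by
    rw [Fintype.card_prod, Fintype.card_fin, Fintype.card_fin, Nat.cast_mul,
      log2_mul (Nat.cast_pos.2 hA) (Nat.cast_pos.2 hB)]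
  rw [seededConvexSplitState_eq_seedAverage hVU hWU', seededDecoupledState_eq_seedAverage hU hU',
    ← map_sub]
  refine (traceNorm_seedAverage_le fun r => ?_).trans_lt ?_
  · exact (isHermitian_twirl _ (isHermitian_twirl _ hρ.isHermitian)).sub
      (isHermitian_twirl _ (isHermitian_twirl _ hρ.isHermitian))
  · rw [inv_mul_lt_iff₀ (Nat.cast_pos.2 Fintype.card_pos)]
    refine sum_traceNorm_twirl_mul_twirl_sub_lt hU hU' hh hh' hρ hρ0 hc ?_ ?_ (hlog ▸ hXYM)
    · rwa [Fintype.card_fin]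
    · rwa [Fintype.card_fin]

end SeedRegisters

theorem mainTheorem13_general {x y m S T : Type*} [Fintype x] [DecidableEq x] [Fintype y]
    [DecidableEq y] [Fintype m] [DecidableEq m] [Fintype S] [DecidableEq S] [Nonempty S]
    [Fintype T] [DecidableEq T] [Nonempty T] {ρ : Matrix (x × y × m) (x × y × m) ℂ}
    (hρ : ρ.PosSemidef) (hρ0 : ρ ≠ 0) {A B : ℕ} {ε : ℝ} (hε0 : 0 < ε)
    {V : Fin A → Matrix (x × S) (x × S) ℂ} (hV : IsHashDesignFamily V)
    {W : Fin B → Matrix (y × T) (y × T) ℂ} (hW : IsHashDesignFamily W)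
    (hXM : smoothRenyiTwo ε (marginalXM ρ) (mixed x ⊗ₖ marginalM ρ) + log2 ((ε ^ 2)⁻¹)
      < log2 A)
    (hYM : smoothRenyiTwo ε (marginalYM ρ) (mixed y ⊗ₖ marginalM ρ) + log2 ((ε ^ 2)⁻¹)
      < log2 B)
    (hXYM : smoothRenyiTwo ε ρ (mixed x ⊗ₖ (mixed y ⊗ₖ marginalM ρ)) + log2 ((ε ^ 2)⁻¹)
      < log2 A + log2 B) :
    traceNorm (seededConvexSplitState V W ρ - seededDecoupledState S T ρ)
        < 8 * ε * (ρ.trace.re + √ρ.trace.re) ∧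
      (smoothRenyiTwo ε (marginalXM ρ) (mixed x ⊗ₖ marginalM ρ) + log2 ((ε ^ 2)⁻¹)
          + log2 (ρ.trace.re)⁻¹ < log2 A →
        smoothRenyiTwo ε (marginalYM ρ) (mixed y ⊗ₖ marginalM ρ) + log2 ((ε ^ 2)⁻¹)
          + log2 (ρ.trace.re)⁻¹ < log2 B →
        smoothRenyiTwo ε ρ (mixed x ⊗ₖ (mixed y ⊗ₖ marginalM ρ)) + log2 ((ε ^ 2)⁻¹)
          + log2 (ρ.trace.re)⁻¹ < log2 A + log2 B →
        traceNorm (seededConvexSplitState V W ρ - seededDecoupledState S T ρ)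
          < 16 * ε * ρ.trace.re) := by
  have htr := re_trace_pos hρ hρ0
  have hε2 : 0 < ε ^ 2 := pow_pos hε0 2
  refine ⟨?_, fun hXM' hYM' hXYM' => ?_⟩
  · have hlt := traceNorm_seededConvexSplitState_sub_lt hρ hρ0 hε2 hV hW hXM hYM hXYM
    rw [Real.sqrt_sq hε0.le] at hlt
    exact hlt.trans_eq (by ring)
  · have hlog : log2 (ε ^ 2 * ρ.trace.re)⁻¹ = log2 (ε ^ 2)⁻¹ + log2 (ρ.trace.re)⁻¹ := by
      rw [mul_inv, log2_mul (inv_pos.2 hε2) (inv_pos.2 htr)]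
    rw [add_assoc, ← hlog] at hXM' hYM' hXYM'
    have hlt := traceNorm_seededConvexSplitState_sub_lt hρ hρ0 (mul_pos hε2 htr) hV hW
      hXM' hYM' hXYM'
    rw [Real.sqrt_mul hε2.le, Real.sqrt_sq hε0.le, mul_left_comm √ρ.trace.re,
      Real.mul_self_sqrt htr.le] at hlt
    exact hlt.trans_eq (by ring)

end ConvexSplit

end

theorem mainTheorem13 {x y m : Type*} [Fintype x] [DecidableEq x] [Fintype y] [DecidableEq y]
    [Fintype m] [DecidableEq m]
    (ρ : Matrix (x × y × m) (x × y × m) ℂ) (hρ : IsSubnormalized ρ) (hρ0 : ρ ≠ 0)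
    (A B : ℕ) (hA : 0 < A) (hB : 0 < B) (ε : ℝ) (hε0 : 0 < ε) (hε1 : ε < 1)
    (V : Fin A → Matrix (x × Four x) (x × Four x) ℂ) (hV : IsHashDesignFamily V)
    (W : Fin B → Matrix (y × Four y) (y × Four y) ℂ) (hW : IsHashDesignFamily W)
    (hXM : smoothRenyiTwo ε (marginalXM ρ) (mixed x ⊗ₖ marginalM ρ) + log2 ((ε ^ 2)⁻¹)
      < log2 A)
    (hYM : smoothRenyiTwo ε (marginalYM ρ) (mixed y ⊗ₖ marginalM ρ) + log2 ((ε ^ 2)⁻¹)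
      < log2 B)
    (hXYM : smoothRenyiTwo ε ρ (mixed x ⊗ₖ (mixed y ⊗ₖ marginalM ρ)) + log2 ((ε ^ 2)⁻¹)
      < log2 A + log2 B) :
    traceNorm (convexSplitState V W ρ - decoupledState ρ)
        < 8 * ε * (ρ.trace.re + Real.sqrt ρ.trace.re) ∧
      (smoothRenyiTwo ε (marginalXM ρ) (mixed x ⊗ₖ marginalM ρ) + log2 ((ε ^ 2)⁻¹)
          + log2 (ρ.trace.re)⁻¹ < log2 A →
        smoothRenyiTwo ε (marginalYM ρ) (mixed y ⊗ₖ marginalM ρ) + log2 ((ε ^ 2)⁻¹)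
          + log2 (ρ.trace.re)⁻¹ < log2 B →
        smoothRenyiTwo ε ρ (mixed x ⊗ₖ (mixed y ⊗ₖ marginalM ρ)) + log2 ((ε ^ 2)⁻¹)
          + log2 (ρ.trace.re)⁻¹ < log2 A + log2 B →
        traceNorm (convexSplitState V W ρ - decoupledState ρ) < 16 * ε * ρ.trace.re) := by
  obtain ⟨⟨i, j, _⟩⟩ := nonempty_of_ne_zero hρ0
  have : Nonempty x := ⟨i⟩
  have : Nonempty y := ⟨j⟩
  exact mainTheorem13_general hρ.1 hρ0 hε0 hV hW hXM hYM hXYM
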